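/- Let $\Omega\subset\mathbb{RP}^n$ ($n\ge 1$) be an open properly convex domain (nonempty, and bounded and convex in some affine chart) with its Hilbert metric $d_\Omega(x,y)=\frac12\left|\log\frac{|ay|\,|bx|}{|ax|\,|by|}\right|$, where $a,b$ are the points in which the projective line through $x\ne y$ meets $\partial\Omega$, in the order $a,x,y,b$. Let $\Gamma<\mathrm{PSL}(n+1,\mathbb R)$ be a discrete torsion-free group that preserves $\Omega$ and for which $M=\Omega/\Gamma$ is compact. Let $SM=S\Omega/\Gamma$ be the unit tangent bundle of $M$ for the Finsler norm of the Hilbert metric, $\pi:SM\to M$ the footpoint projection, and $\phi^t:SM\to SM$ the geodesic flow, which moves unit tangent vectors along projective lines at unit Hilbert speed. Let $d_M$ be the quotient metric on $M$, and let $\mathrm{inj}(M)=\inf_{x\in M}\frac12\inf_\ell \mathrm{length}(\ell)$, where $\ell$ runs over the homotopically nontrivial loops through $x$ (lengths are taken for $d_M$). Let $d$ be a metric on $SM$ that induces its topology. For $K\subset SM$ put $d_t(v,u)=\max_{0\le s\le t}d(\phi^sv,\phi^su)$, let $S(t,\delta,K)$ be the least cardinality of a set that is $\delta$-dense in $K$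 for $d_t$, and put $$h_{top}(\phi,K)=\lim_{\delta\to0}\limsup_{t\to\infty}\frac1t\log S(t,\delta,K).$$ For $\varepsilon>0$ and $v\in SM$ put $\Phi_\varepsilon(v)=\{y\in SM : d(\phi^ty,\phi^tv)\le\varepsilon\text{ for all }t\ge0\}$ and $h^*(\varepsilon)=\sup_{v\in SM}h_{top}(\phi,\Phi_\varepsilon(v))$. The flow $\phi$ is $h$-expansive with expansivity constant $\varepsilon>0$ if $h^*(\varepsilon)=0$. Then: 1. For every metric $d$ on $SM$ that induces the topology, the geodesic flow $\phi^t$ is $h$-expansive, that is, it is $h$-expansive with some expansivity constant $\varepsilon>0$. 2. If moreover $d$ is normalized so that $d_M(\pi v,\pi u)\le d(v,u)$ for all $v,u\in SM$, then every $\varepsilon$ with $0<\varepsilon<\mathrm{inj}(M)/3$ is an expansivity constant; that is, $h^*(\varepsilon)=0$, so the sets $\Phi_\varepsilon(v)$ carry zero topological entropy. -/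

import Mathlib

open Filter Topology Set
open scoped ENNReal Pointwise LinearAlgebra.Projectivization Matrix MatrixGroups

noncomputable section

/-! ### Entropy of a flow on a metric space -/

namespace FlowEntropy

variable {X : Type*}

/-- `d` is a metric on the topological space `X` which induces the topology of `X`. -/
structure IsCompatibleMetric [TopologicalSpace X] (d : X → X → ℝ) : Prop where
  self_eq_zero : ∀ x, d x x = 0
  eq_of_eq_zero : ∀ x y, d x y = 0 → x = y
  symm : ∀ x y, d x y = d y x
  triangle : ∀ x y z, d x z ≤ d x y + d y z
  isOpen_iff : ∀ U : Set X, IsOpen U ↔ ∀ x ∈ U, ∃ r > 0, ∀ y, d x y < r → y ∈ U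

/-- The Bowen distance `d_t(v, u) = max_{0 ≤ s ≤ t} d(φ^s v, φ^s u)`. -/
def bowenDist (d : X → X → ℝ) (φ : ℝ → X → X) (t : ℝ) (v u : X) : ℝ :=
  sSup ((fun s => d (φ s v) (φ s u)) '' Icc 0 t)

/-- `E` is a `(t, δ)`-spanning set for `K`: it is `δ`-dense in `K` for the Bowen distance `d_t`. -/
def IsSpanning (d : X → X → ℝ) (φ : ℝ → X → X) (t δ : ℝ) (K : Set X) (E : Finset X) : Prop :=
  ∀ v ∈ K, ∃ u ∈ E, bowenDist d φ t v u < δ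

/-- The minimal cardinality `S(t, δ, K)` of a finite `(t, δ)`-spanning set for `K`. -/
def spanningNumber (d : X → X → ℝ) (φ : ℝ → X → X) (t δ : ℝ) (K : Set X) : ℕ∞ :=
  ⨅ (E : Finset X) (_ : IsSpanning d φ t δ K E), (E.card : ℕ∞)

/-- The exponential growth rate in `t` of `S(t, δ, K)`, taken as a limit superior. -/
def entropyAtScale (d : X → X → ℝ) (φ : ℝ → X → X) (K : Set X) (δ : ℝ) : EReal :=
  limsup (fun t : ℝ => ENNReal.log (spanningNumber d φ t δ K : ℝ≥0∞) / (t : EReal)) atTop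

/-- The topological entropy `h_top(φ, K)`: the limit of `entropyAtScale d φ K δ` as `δ → 0`, which
is the supremum over `δ > 0` because `S(t, δ, K)` does not decrease when `δ` decreases. -/
def topEntropy (d : X → X → ℝ) (φ : ℝ → X → X) (K : Set X) : EReal :=
  ⨆ (δ : ℝ) (_ : 0 < δ), entropyAtScale d φ K δ

/-- The infinite Bowen ball
`Φ_ε(v) = {y | d(φ^t y, φ^t v) ≤ ε for all t ≥ 0}`. -/
def infBowenBall (d : X → X → ℝ) (φ : ℝ → X → X) (ε : ℝ) (v : X) : Set X :=
  {y | ∀ t : ℝ, 0 ≤ t → d (φ t y) (φ t v) ≤ ε}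

/-- `h*(ε) = sup_v h_top(φ, Φ_ε(v))`. -/
def hStar (d : X → X → ℝ) (φ : ℝ → X → X) (ε : ℝ) : EReal :=
  ⨆ v : X, topEntropy d φ (infBowenBall d φ ε v)

/-- `φ` is `h`-expansive with expansivity constant `ε`. -/
def IsHExpansiveWith (d : X → X → ℝ) (φ : ℝ → X → X) (ε : ℝ) : Prop :=
  0 < ε ∧ hStar d φ ε = 0

/-- The length of a path for the metric `d`: the supremum over all partitions
`u 0 ≤ u 1 ≤ … ≤ u N` of the parameter interval of the sums of the distances. -/
def pathLength [TopologicalSpace X] (d : X → X → ℝ) {x y : X} (ℓ : Path x y) : ℝ≥0∞ :=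
  ⨆ (N : ℕ) (u : ℕ → unitInterval) (_ : Monotone u),
    ∑ i ∈ Finset.range N, ENNReal.ofReal (d (ℓ (u i)) (ℓ (u (i + 1))))

/-- The injectivity radius at `x`: half the infimum of the lengths of the homotopically nontrivial
loops through `x` (it is `∞` when there are none). -/
def injRadiusAt [TopologicalSpace X] (d : X → X → ℝ) (x : X) : ℝ≥0∞ :=
  (⨅ (ℓ : Path x x) (_ : ¬ ℓ.Homotopic (Path.refl x)), pathLength d ℓ) / 2

/-- The injectivity radius of the whole space. -/
def injRadius [TopologicalSpace X] (d : X → X → ℝ) : ℝ≥0∞ :=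
  ⨅ x : X, injRadiusAt d x

end FlowEntropy

/-! ### Properly convex domains and their Hilbert geometry -/

/-- A (nonempty, open) properly convex domain `Ω` in `ℝPⁿ = ℙ(ℝⁿ⁺¹)`, together with an affine chart
in which it is bounded and convex. The affine chart attached to a linear form `f` on `ℝⁿ⁺¹` is
`{f ≠ 0} ⊆ ℝPⁿ`, identified with the affine hyperplane `{f = 1}` of `ℝⁿ⁺¹`. -/
structure ProperlyConvexDomain (n : ℕ) where
  carrier : Set (ℙ ℝ (Fin (n + 1) → ℝ))
  chart : (Fin (n + 1) → ℝ) →L[ℝ] ℝ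
  nonempty : carrier.Nonempty
  isOpen_cone : IsOpen {x | ∃ h : x ≠ 0, Projectivization.mk ℝ x h ∈ carrier}
  chart_ne_zero : ∀ x (h : x ≠ 0), Projectivization.mk ℝ x h ∈ carrier → chart x ≠ 0
  convex : Convex ℝ {x | chart x = 1 ∧ ∃ h : x ≠ 0, Projectivization.mk ℝ x h ∈ carrier}
  isBounded : Bornology.IsBounded
    {x | chart x = 1 ∧ ∃ h : x ≠ 0, Projectivization.mk ℝ x h ∈ carrier}

namespace ProperlyConvexDomain

variable {n : ℕ} (Ω : ProperlyConvexDomain n)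

/-- The domain `Ω` seen in its affine chart, as a subset of the hyperplane `{chart = 1}`. -/
def slice : Set (Fin (n + 1) → ℝ) :=
  {x | Ω.chart x = 1 ∧ ∃ h : x ≠ 0, Projectivization.mk ℝ x h ∈ Ω.carrier}

/-- The points of `Ω` (in the affine chart), with the subspace topology. -/
abbrev Point : Type := {x : Fin (n + 1) → ℝ // x ∈ Ω.slice}

/-- For `x ∈ Ω` and a direction `w ≠ 0` of the chart, the parameter at which the ray `s ↦ x + s w`
leaves `Ω`. -/
def exitTime (x w : Fin (n + 1) → ℝ) : ℝ := sSup {s : ℝ | x + s • w ∈ Ω.slice}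

/-- The point of `∂Ω` at which the ray from `x` in direction `w` leaves `Ω`. -/
def endpoint (x w : Fin (n + 1) → ℝ) : Fin (n + 1) → ℝ := x + Ω.exitTime x w • w

/-- The Hilbert distance `½ |log [a, x, y, b]|`, `[a, x, y, b] = (|ay| / |ax|) (|bx| / |by|)`, with
`a`, `b` the intersection points with `∂Ω` of the line through `x` and `y`, in the order
`a, x, y, b` (for `x = y` the formula returns `0`). -/
def hilbertDist (x y : Fin (n + 1) → ℝ) : ℝ :=
  let a := Ω.endpoint x (x - y)
  let b := Ω.endpoint x (y - x)
  1 / 2 * |Real.log ((dist a y / dist a x) * (dist b x / dist b y))|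

/-- The Finsler norm of the Hilbert metric,
`F(x, w) = (|w| / 2) (1 / |x w⁺| + 1 / |x w⁻|)`; here `|x w^±| / |w|` is the exit time of the ray
from `x` in direction `±w`. -/
def finslerNorm (x w : Fin (n + 1) → ℝ) : ℝ :=
  1 / 2 * ((Ω.exitTime x w)⁻¹ + (Ω.exitTime x (-w))⁻¹)

/-- The Finsler unit tangent bundle `SΩ`: pairs `(x, w)` of a point of `Ω` and a tangent vector of
the chart hyperplane at `x` with Finsler norm one. -/
abbrev UnitTangent : Type :=
  {p : (Fin (n + 1) → ℝ) × (Fin (n + 1) → ℝ) //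
    p.1 ∈ Ω.slice ∧ Ω.chart p.2 = 0 ∧ Ω.finslerNorm p.1 p.2 = 1}

/-- The projective line through `x` in direction `w`, parametrized by Hilbert arc length when
`F(x, w) = 1`: the solution `s = s(t)` of `½ log ((1 + a s) / (1 - b s)) = t`, where
`a⁻¹`, `b⁻¹` are the exit times in the directions `-w`, `w`; the left side is the oriented
Hilbert distance from `x` to `x + s w`. -/
def geodesic (x w : Fin (n + 1) → ℝ) (t : ℝ) : Fin (n + 1) → ℝ :=
  x + ((Real.exp (2 * t) - 1) /
    ((Ω.exitTime x (-w))⁻¹ + (Ω.exitTime x w)⁻¹ * Real.exp (2 * t))) • w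

/-- The automorphism group `{g ∈ PSL(n+1, ℝ) | g Ω = Ω}`. -/
abbrev aut : Subgroup PSL(n + 1, ℝ) := MulAction.stabilizer PSL(n + 1, ℝ) Ω.carrier

/-- The projective transformation of a matrix, in the affine chart. -/
def chartMap (A : Matrix (Fin (n + 1)) (Fin (n + 1)) ℝ) (x : Fin (n + 1) → ℝ) :
    Fin (n + 1) → ℝ :=
  (Ω.chart (A *ᵥ x))⁻¹ • (A *ᵥ x)

/-- A matrix representing an element of `PSL(n+1, ℝ)`. -/
def repMatrix (g : PSL(n + 1, ℝ)) : Matrix (Fin (n + 1)) (Fin (n + 1)) ℝ :=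
  (Quotient.out g : Matrix.SpecialLinearGroup (Fin (n + 1)) ℝ)

variable {Ω}

theorem mem_slice {x : Fin (n + 1) → ℝ} : x ∈ Ω.slice ↔
    Ω.chart x = 1 ∧ ∃ h : x ≠ 0, Projectivization.mk ℝ x h ∈ Ω.carrier := Iff.rfl

theorem exitTime_spec {x w : Fin (n + 1) → ℝ} (hx : x ∈ Ω.slice) (hw : Ω.chart w = 0)
    (hw0 : w ≠ 0) :
    0 < Ω.exitTime x w ∧ ∀ s : ℝ, 0 ≤ s → (x + s • w ∈ Ω.slice ↔ s < Ω.exitTime x w) := by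
  set I : Set ℝ := {s : ℝ | x + s • w ∈ Ω.slice} with hI
  have hcont : Continuous (fun s : ℝ => x + s • w) := by fun_prop
  have hIo : IsOpen I := by
    have : I = (fun s : ℝ => x + s • w) ⁻¹'
        {x | ∃ h : x ≠ 0, Projectivization.mk ℝ x h ∈ Ω.carrier} := by
      ext s
      simp [hI, mem_slice, hw, hx.1]
    rw [this]
    exact Ω.isOpen_cone.preimage hcont
  have hIc : Convex ℝ I := by
    intro s hs r hr a b ha hb hab
    have := Ω.convex hs hr ha hb hab
    have e : x + (a • s + b • r) • w = a • (x + s • w) + b • (x + r • w) := by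
      have : x = (a + b) • x := by rw [hab, one_smul]
      nth_rewrite 1 [this]
      simp only [smul_add, add_smul, smul_smul, smul_eq_mul]
      abel
    change x + (a • s + b • r) • w ∈ Ω.slice
    rw [e]
    exact this
  have h0 : (0 : ℝ) ∈ I := by simpa [hI] using hx
  have hbd : BddAbove I := by
    obtain ⟨R, hR⟩ := Ω.isBounded.exists_norm_le
    refine ⟨(R + ‖x‖) / ‖w‖, fun s hs => ?_⟩
    have h1 := hR _ hs
    rw [le_div_iff₀ (norm_pos_iff.2 hw0)]
    have h2 : ‖s • w‖ ≤ ‖x + s • w‖ + ‖x‖ := by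
      have := norm_sub_le (x + s • w) x
      simpa using this
    rw [norm_smul] at h2
    have := mul_le_mul_of_nonneg_right (le_abs_self s) (norm_nonneg w)
    rw [Real.norm_eq_abs] at h2
    linarith
  have hlt : ∀ s ∈ I, s < sSup I := by
    intro s hs
    obtain ⟨ε, hε, hball⟩ := Metric.isOpen_iff.1 hIo s hs
    have : s + ε / 2 ∈ I := hball (by simp [abs_of_pos hε]; linarith)
    have := le_csSup hbd this
    linarith
  refine ⟨hlt 0 h0, fun s hs => ⟨hlt s, fun h => ?_⟩⟩
  obtain ⟨r, hr, hsr⟩ := exists_lt_of_lt_csSup ⟨0, h0⟩ h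
  exact hIc.ordConnected.out h0 hr ⟨hs, hsr.le⟩

theorem line_mem_iff {x w : Fin (n + 1) → ℝ} (hx : x ∈ Ω.slice) (hw : Ω.chart w = 0)
    (hw0 : w ≠ 0) (s : ℝ) :
    x + s • w ∈ Ω.slice ↔ -Ω.exitTime x (-w) < s ∧ s < Ω.exitTime x w := by
  obtain ⟨h1, h2⟩ := exitTime_spec hx hw hw0
  obtain ⟨h3, h4⟩ := exitTime_spec hx (w := -w) (by simp [hw]) (by simpa using hw0)
  rcases le_total 0 s with hs | hs
  · rw [h2 s hs]
    constructor
    · intro h; exact ⟨by linarith, h⟩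
    · exact fun h => h.2
  · have := h4 (-s) (by linarith)
    simp only [smul_neg, neg_smul, neg_neg] at this
    rw [this]
    constructor
    · intro h; exact ⟨by linarith, by linarith⟩
    · intro h; linarith [h.1]

theorem exitTime_eq {x w : Fin (n + 1) → ℝ} {α β : ℝ} (hα : 0 < α) (hβ : 0 < β)
    (h : ∀ s : ℝ, x + s • w ∈ Ω.slice ↔ -α < s ∧ s < β) :
    Ω.exitTime x w = β ∧ Ω.exitTime x (-w) = α := by
  constructor
  · have : {s : ℝ | x + s • w ∈ Ω.slice} = Ioo (-α) β := by ext s; exact h s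
    rw [exitTime, this, csSup_Ioo (by linarith)]
  · have : {s : ℝ | x + s • (-w) ∈ Ω.slice} = Ioo (-β) α := by
      ext s
      have := h (-s)
      rw [neg_smul, ← smul_neg] at this
      rw [Set.mem_ofPred_eq, this, mem_Ioo]
      constructor <;> rintro ⟨h1, h2⟩ <;> constructor <;> linarith
    rw [exitTime, this, csSup_Ioo (by linarith)]

theorem ne_zero_of_finslerNorm {x w : Fin (n + 1) → ℝ} (h : Ω.finslerNorm x w = 1) : w ≠ 0 := by
  rintro rfl
  have : Ω.exitTime x 0 = 0 := by
    by_cases hx : x ∈ Ω.slice <;> simp [exitTime, hx]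
  simp [finslerNorm, this] at h

/-! The geodesic flow on the unit tangent bundle of the domain. -/

theorem hasDerivAt_geodesic (v : Ω.UnitTangent) (t : ℝ) :
    HasDerivAt (Ω.geodesic v.1.1 v.1.2)
      ((4 * Real.exp (2 * t) / ((Ω.exitTime v.1.1 (-v.1.2))⁻¹ +
        (Ω.exitTime v.1.1 v.1.2)⁻¹ * Real.exp (2 * t)) ^ 2) • v.1.2) t := by
  obtain ⟨⟨x, w⟩, hx, hw, hF⟩ := v
  dsimp only at *
  have hw0 := ne_zero_of_finslerNorm hF
  have hb := inv_pos.2 (exitTime_spec hx hw hw0).1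
  have ha := inv_pos.2 (exitTime_spec hx (w := -w) (by simp [hw]) (by simpa using hw0)).1
  unfold finslerNorm at hF
  unfold geodesic
  set a := (Ω.exitTime x (-w))⁻¹
  set b := (Ω.exitTime x w)⁻¹
  have hD : a + b * Real.exp (2 * t) ≠ 0 := by positivity
  have hE : HasDerivAt (fun t : ℝ => Real.exp (2 * t)) (Real.exp (2 * t) * 2) t := by
    have := ((hasDerivAt_id t).const_mul 2).exp
    simpa using this
  have := (((hE.sub_const 1).div ((hE.const_mul b).const_add a) hD).smul_const w).const_add x
  refine HasDerivAt.congr_deriv this ?_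
  congr 1
  have hab : a = 2 - b := by linarith
  rw [hab]
  ring

theorem flow_mem (v : Ω.UnitTangent) (t : ℝ) :
    Ω.geodesic v.1.1 v.1.2 t ∈ Ω.slice ∧
      Ω.chart (deriv (Ω.geodesic v.1.1 v.1.2) t) = 0 ∧
      Ω.finslerNorm (Ω.geodesic v.1.1 v.1.2 t) (deriv (Ω.geodesic v.1.1 v.1.2) t) = 1 := by
  rw [(hasDerivAt_geodesic v t).deriv]
  obtain ⟨⟨x, w⟩, hx, hw, hF⟩ := v
  dsimp only at *
  have hw0 := ne_zero_of_finslerNorm hF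
  have hmem := line_mem_iff hx hw hw0
  have hβ := (exitTime_spec hx hw hw0).1
  have hα := (exitTime_spec hx (w := -w) (by simp [hw]) (by simpa using hw0)).1
  unfold finslerNorm at hF
  unfold geodesic
  obtain ⟨a, ha⟩ : ∃ a, a = (Ω.exitTime x (-w))⁻¹ := ⟨_, rfl⟩
  obtain ⟨b, hb⟩ : ∃ b, b = (Ω.exitTime x w)⁻¹ := ⟨_, rfl⟩
  have ha0 : 0 < a := ha ▸ inv_pos.2 hα
  have hb0 : 0 < b := hb ▸ inv_pos.2 hβ
  have hα' : Ω.exitTime x (-w) = a⁻¹ := by simp [ha]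
  have hβ' : Ω.exitTime x w = b⁻¹ := by simp [hb]
  simp only [hα', hβ', inv_inv] at hF hmem ⊢
  have hE : 0 < Real.exp (2 * t) := Real.exp_pos _
  set E := Real.exp (2 * t)
  have hD : 0 < a + b * E := by positivity
  have hab : a = 2 - b := by linarith
  have hs1 : a⁻¹ + (E - 1) / (a + b * E) = 2 * E / (a * (a + b * E)) := by
    field_simp; rw [hab]; ring
  have hs2 : b⁻¹ - (E - 1) / (a + b * E) = 2 / (b * (a + b * E)) := by
    field_simp; rw [hab]; ring
  have hs1' : 0 < 2 * E / (a * (a + b * E)) := by positivity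
  have hs2' : 0 < 2 / (b * (a + b * E)) := by positivity
  set s := (E - 1) / (a + b * E)
  have hc : 0 < 4 * E / (a + b * E) ^ 2 := by positivity
  refine ⟨(hmem s).2 ⟨by linarith, by linarith⟩, by simp [hw], ?_⟩
  have key : ∀ r : ℝ, (x + s • w) + r • (4 * E / (a + b * E) ^ 2) • w ∈ Ω.slice ↔
      -((a + b * E) / (2 * a)) < r ∧ r < (a + b * E) / (2 * b * E) := by
    intro r
    rw [smul_smul, add_assoc, ← add_smul, hmem]
    have e1 : (a + b * E) / (2 * a) = (a⁻¹ + s) / (4 * E / (a + b * E) ^ 2) := by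
      rw [hs1]; field_simp; norm_num
    have e2 : (a + b * E) / (2 * b * E) = (b⁻¹ - s) / (4 * E / (a + b * E) ^ 2) := by
      rw [hs2]; field_simp; norm_num
    rw [e1, e2, lt_div_iff₀ hc, ← neg_div, div_lt_iff₀ hc]
    constructor <;> rintro ⟨h1, h2⟩ <;> constructor <;> linarith
  obtain ⟨k1, k2⟩ := exitTime_eq (by positivity) (by positivity) key
  rw [finslerNorm, k1, k2]
  field_simp
  linarith

/-- The geodesic flow on `SΩ`: `φ^t (x, w) = (ℓ(t), ℓ'(t))`, where `ℓ` is the projective line through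
`x` in direction `w` at unit Hilbert speed. -/
def flow (Ω : ProperlyConvexDomain n) (t : ℝ) (v : Ω.UnitTangent) : Ω.UnitTangent :=
  ⟨(Ω.geodesic v.1.1 v.1.2 t, deriv (Ω.geodesic v.1.1 v.1.2) t), flow_mem v t⟩

/-! The action of the automorphism group. -/

theorem repMatrix_spec (g : PSL(n + 1, ℝ)) :
    ((Quotient.out g : Matrix.SpecialLinearGroup (Fin (n + 1)) ℝ) : PSL(n + 1, ℝ)) = g :=
  QuotientGroup.out_eq' g

theorem exists_smul_of_mk_eq {A B : Matrix.SpecialLinearGroup (Fin (n + 1)) ℝ}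
    (h : (A : PSL(n + 1, ℝ)) = (B : PSL(n + 1, ℝ))) :
    ∃ c : ℝ, c ≠ 0 ∧ (B : Matrix (Fin (n + 1)) (Fin (n + 1)) ℝ) = c • (A : Matrix _ _ ℝ) := by
  rw [QuotientGroup.eq, Matrix.SpecialLinearGroup.mem_center_iff] at h
  obtain ⟨r, hr, hrA⟩ := h
  refine ⟨r, fun h0 => by simp [h0] at hr, ?_⟩
  have : (B : Matrix (Fin (n + 1)) (Fin (n + 1)) ℝ) = (A * (A⁻¹ * B) :) := by
    rw [mul_inv_cancel_left]
  rw [this, Matrix.SpecialLinearGroup.coe_mul, ← hrA]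
  simp [Matrix.smul_eq_mul_diagonal, Matrix.scalar_apply]

theorem repMatrix_one : ∃ c : ℝ, c ≠ 0 ∧ repMatrix (1 : PSL(n + 1, ℝ)) = c • 1 := by
  have := exists_smul_of_mk_eq (n := n) (A := 1) (B := Quotient.out (1 : PSL(n + 1, ℝ)))
    (by rw [repMatrix_spec]; rfl)
  simpa [repMatrix] using this

theorem repMatrix_mul (g h : PSL(n + 1, ℝ)) :
    ∃ c : ℝ, c ≠ 0 ∧ repMatrix (g * h) = c • (repMatrix g * repMatrix h) := by
  have := exists_smul_of_mk_eq (n := n) (A := Quotient.out g * Quotient.out h)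
    (B := Quotient.out (g * h)) (by rw [QuotientGroup.mk_mul, repMatrix_spec, repMatrix_spec,
      repMatrix_spec])
  simpa [repMatrix] using this

theorem repMatrix_mem (g : Ω.aut) {x : Fin (n + 1) → ℝ}
    (hx : ∃ h : x ≠ 0, Projectivization.mk ℝ x h ∈ Ω.carrier) :
    ∃ h : repMatrix g.1 *ᵥ x ≠ 0,
      Projectivization.mk ℝ (repMatrix g.1 *ᵥ x) h ∈ Ω.carrier := by
  obtain ⟨h, hx⟩ := hx
  have h1 : g.1 • Projectivization.mk ℝ x h ∈ Ω.carrier := by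
    have := g.2
    rw [MulAction.mem_stabilizer_iff] at this
    rw [← this]
    exact Set.smul_mem_smul_set hx
  rw [← repMatrix_spec g.1, Matrix.ProjectiveSpecialLinearGroup.smul_proj_mk,
    Projectivization.smul_mk] at h1
  exact ⟨_, h1⟩

theorem chart_rep_ne_zero (g : Ω.aut) {x : Fin (n + 1) → ℝ} (hx : x ∈ Ω.slice) :
    Ω.chart (repMatrix g.1 *ᵥ x) ≠ 0 := by
  obtain ⟨h, h1⟩ := repMatrix_mem g hx.2
  exact Ω.chart_ne_zero _ h h1

theorem chartMap_mem (g : Ω.aut) {x : Fin (n + 1) → ℝ} (hx : x ∈ Ω.slice) :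
    Ω.chartMap (repMatrix g.1) x ∈ Ω.slice := by
  obtain ⟨h, h1⟩ := repMatrix_mem g hx.2
  have h2 := chart_rep_ne_zero g hx
  refine ⟨by simp [chartMap, h2], smul_ne_zero (inv_ne_zero h2) h, ?_⟩
  convert h1 using 1
  exact (Projectivization.mk_eq_mk_iff' ℝ _ _ _ _).2 ⟨_, rfl⟩

theorem chartMap_smul {c : ℝ} (hc : c ≠ 0) (A : Matrix (Fin (n + 1)) (Fin (n + 1)) ℝ) :
    Ω.chartMap (c • A) = Ω.chartMap A := by
  funext x
  simp only [chartMap, Matrix.smul_mulVec, map_smul, smul_smul, smul_eq_mul, mul_inv]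
  congr 1
  field_simp

theorem chartMap_one (x : Fin (n + 1) → ℝ) : Ω.chartMap 1 x = (Ω.chart x)⁻¹ • x := by
  simp [chartMap]

theorem chartMap_mul (A B : Matrix (Fin (n + 1)) (Fin (n + 1)) ℝ) (x : Fin (n + 1) → ℝ)
    (h : Ω.chart (B *ᵥ x) ≠ 0) :
    Ω.chartMap (A * B) x = Ω.chartMap A (Ω.chartMap B x) := by
  simp only [chartMap, Matrix.mulVec_smul, map_smul, smul_smul, smul_eq_mul, mul_inv, inv_inv,
    Matrix.mulVec_mulVec]
  congr 1
  field_simp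

theorem hasFDerivAt_chartMap (A : Matrix (Fin (n + 1)) (Fin (n + 1)) ℝ) {x : Fin (n + 1) → ℝ}
    (h : Ω.chart (A *ᵥ x) ≠ 0) :
    HasFDerivAt (Ω.chartMap A) (fderiv ℝ (Ω.chartMap A) x) x ∧
    ∀ w, fderiv ℝ (Ω.chartMap A) x w =
      (Ω.chart (A *ᵥ x))⁻¹ • (A *ᵥ w) -
        (Ω.chart (A *ᵥ w) * ((Ω.chart (A *ᵥ x)) ^ 2)⁻¹) • (A *ᵥ x) := by
  let L : (Fin (n + 1) → ℝ) →L[ℝ] (Fin (n + 1) → ℝ) := LinearMap.toContinuousLinearMap A.mulVecLin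
  have h1 : HasFDerivAt (fun y => L y) L x := L.hasFDerivAt
  have h2 : HasFDerivAt (fun y => Ω.chart (L y)) (Ω.chart.comp L) x := (Ω.chart.comp L).hasFDerivAt
  have h3 := (((hasDerivAt_inv (x := Ω.chart (L x)) h).comp_hasFDerivAt x h2).smul h1)
  have h4 : HasFDerivAt (Ω.chartMap A) _ x := h3
  refine ⟨h4.differentiableAt.hasFDerivAt, fun w => ?_⟩
  rw [h4.fderiv]
  simp [L, sub_eq_add_neg, mul_comm]

theorem fderiv_chartMap_mul (A B : Matrix (Fin (n + 1)) (Fin (n + 1)) ℝ) {x : Fin (n + 1) → ℝ}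
    (h : Ω.chart (B *ᵥ x) ≠ 0) (h' : Ω.chart (A *ᵥ Ω.chartMap B x) ≠ 0) (w : Fin (n + 1) → ℝ) :
    fderiv ℝ (Ω.chartMap (A * B)) x w =
      fderiv ℝ (Ω.chartMap A) (Ω.chartMap B x) (fderiv ℝ (Ω.chartMap B) x w) := by
  have hB := (hasFDerivAt_chartMap B h).1
  have hA := (hasFDerivAt_chartMap A h').1
  have hc := hA.comp x hB
  have hev : Ω.chartMap (A * B) =ᶠ[𝓝 x] Ω.chartMap A ∘ Ω.chartMap B := by
    have : Continuous fun y => Ω.chart (B *ᵥ y) :=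
      Ω.chart.continuous.comp (continuous_const.matrix_mulVec continuous_id)
    filter_upwards [this.continuousAt.eventually_ne h] with y hy
    exact chartMap_mul A B y hy
  rw [hev.fderiv_eq, hc.fderiv]
  rfl

theorem chart_fderiv (A : Matrix (Fin (n + 1)) (Fin (n + 1)) ℝ) {x : Fin (n + 1) → ℝ}
    (h : Ω.chart (A *ᵥ x) ≠ 0) (w : Fin (n + 1) → ℝ) :
    Ω.chart (fderiv ℝ (Ω.chartMap A) x w) = 0 := by
  rw [(hasFDerivAt_chartMap A h).2]
  simp only [map_sub, map_smul, smul_eq_mul]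
  field_simp
  ring

theorem chartMap_act_mul (g h : Ω.aut) {x : Fin (n + 1) → ℝ} (hx : x ∈ Ω.slice)
    (w : Fin (n + 1) → ℝ) :
    Ω.chartMap (repMatrix (g * h).1) x =
      Ω.chartMap (repMatrix g.1) (Ω.chartMap (repMatrix h.1) x) ∧
    fderiv ℝ (Ω.chartMap (repMatrix (g * h).1)) x w =
      fderiv ℝ (Ω.chartMap (repMatrix g.1)) (Ω.chartMap (repMatrix h.1) x)
        (fderiv ℝ (Ω.chartMap (repMatrix h.1)) x w) := by
  obtain ⟨c, hc, e⟩ := repMatrix_mul g.1 h.1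
  have h1 := chart_rep_ne_zero h hx
  have h2 := chart_rep_ne_zero g (chartMap_mem h hx)
  rw [Subgroup.coe_mul, e, chartMap_smul hc]
  exact ⟨chartMap_mul _ _ _ h1, fderiv_chartMap_mul _ _ h1 h2 w⟩

theorem chartMap_act_one {x w : Fin (n + 1) → ℝ} (hx : x ∈ Ω.slice) (hw : Ω.chart w = 0) :
    Ω.chartMap (repMatrix (1 : Ω.aut).1) x = x ∧
    fderiv ℝ (Ω.chartMap (repMatrix (1 : Ω.aut).1)) x w = w := by
  obtain ⟨c, hc, e⟩ := repMatrix_one (n := n)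
  rw [Subgroup.coe_one, e, chartMap_smul hc,
    (hasFDerivAt_chartMap 1 (by simp [hx.1])).2, chartMap_one]
  simp [hx.1, hw]

/-- The image of a line under an automorphism, with its change of projective parameter. -/
theorem chartMap_line (g : Ω.aut) {x w : Fin (n + 1) → ℝ} (hx : x ∈ Ω.slice)
    (s : ℝ) (hs : x + s • w ∈ Ω.slice) :
    0 < 1 + Ω.chart (repMatrix g.1 *ᵥ w) / Ω.chart (repMatrix g.1 *ᵥ x) * s ∧
    Ω.chartMap (repMatrix g.1) (x + s • w) = Ω.chartMap (repMatrix g.1) x +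
      (s / (1 + Ω.chart (repMatrix g.1 *ᵥ w) / Ω.chart (repMatrix g.1 *ᵥ x) * s)) •
        fderiv ℝ (Ω.chartMap (repMatrix g.1)) x w := by
  have hl := chart_rep_ne_zero g hx
  set A := repMatrix g.1 with hA
  obtain ⟨l, hl'⟩ : ∃ l, l = Ω.chart (A *ᵥ x) := ⟨_, rfl⟩
  obtain ⟨m, hm⟩ : ∃ m, m = Ω.chart (A *ᵥ w) := ⟨_, rfl⟩
  have hne : ∀ r : ℝ, x + r • w ∈ Ω.slice → 1 + m / l * r ≠ 0 := by
    intro r hr h0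
    have := chart_rep_ne_zero g hr
    rw [← hA, Matrix.mulVec_add, Matrix.mulVec_smul, map_add, map_smul, ← hl', ← hm] at this
    apply this
    have : l + r • m = l * (1 + m / l * r) := by
      rw [hl'] at *
      field_simp
      simp [mul_comm]
    rw [this, h0, mul_zero]
  rw [(hasFDerivAt_chartMap A hl).2, ← hl', ← hm]
  rw [← hl'] at hl
  have hpos : 0 < 1 + m / l * s := by
    by_contra hneg
    have hneg' : 1 + m / l * s < 0 := lt_of_le_of_ne (not_lt.1 hneg) (hne s hs)
    set k := m / l
    have hks : k * s < -1 := by linarith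
    have hks0 : k * s ≠ 0 := by linarith
    have hk : k ≠ 0 := left_ne_zero_of_mul hks0
    have hs0 : s ≠ 0 := right_ne_zero_of_mul hks0
    refine hne (-1 / k) ?_ (by field_simp; ring)
    have hconv := Ω.convex hx hs (a := 1 - (-1 / (k * s))) (b := -1 / (k * s)) ?_ ?_ (by ring)
    · have e : x + (-1 / k) • w =
          (1 - (-1 / (k * s))) • x + (-1 / (k * s)) • (x + s • w) := by
        rw [smul_add, smul_smul, sub_smul, one_smul]
        have : -1 / (k * s) * s = -1 / k := by field_simp
        rw [this]
        abel
      rw [e]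
      exact hconv
    · rw [sub_nonneg, div_le_one_of_neg (by linarith)]
      linarith
    · exact div_nonneg_of_nonpos (by norm_num) (by linarith)
  refine ⟨hpos, ?_⟩
  have hc : Ω.chart (A *ᵥ (x + s • w)) = l * (1 + m / l * s) := by
    rw [Matrix.mulVec_add, Matrix.mulVec_smul, map_add, map_smul, ← hl', ← hm]
    field_simp
    simp [mul_comm]
  rw [chartMap, chartMap, hc, ← hl', Matrix.mulVec_add, Matrix.mulVec_smul]
  set k := m / l with hk
  have hm' : m = k * l := by rw [hk]; field_simp
  rw [hm']
  ext i
  simp only [Pi.smul_apply, Pi.add_apply, Pi.sub_apply, smul_eq_mul]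
  have := hpos.ne'
  field_simp
  ring

theorem fderiv_act_ne_zero (g : Ω.aut) {x w : Fin (n + 1) → ℝ} (hx : x ∈ Ω.slice)
    (hw : Ω.chart w = 0) (hw0 : w ≠ 0) :
    fderiv ℝ (Ω.chartMap (repMatrix g.1)) x w ≠ 0 := by
  intro h
  have h1 := (chartMap_act_mul g⁻¹ g hx w).2
  rw [inv_mul_cancel, (chartMap_act_one hx hw).2, h, map_zero] at h1
  exact hw0 h1

/-- The inverse exit times are changed by an additive constant. -/
theorem exitTime_act_le (g : Ω.aut) {x w : Fin (n + 1) → ℝ} (hx : x ∈ Ω.slice)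
    (hw : Ω.chart w = 0) (hw0 : w ≠ 0) :
    (Ω.exitTime (Ω.chartMap (repMatrix g.1) x) (fderiv ℝ (Ω.chartMap (repMatrix g.1)) x w))⁻¹ ≤
      (Ω.exitTime x w)⁻¹ + Ω.chart (repMatrix g.1 *ᵥ w) / Ω.chart (repMatrix g.1 *ᵥ x) := by
  have hx' := chartMap_mem g hx
  have hw' := chart_fderiv (repMatrix g.1) (chart_rep_ne_zero g hx) w
  have hw0' := fderiv_act_ne_zero g hx hw hw0
  have hl := fun s hs => chartMap_line g hx (w := w) s hs
  obtain ⟨hβ, hI⟩ := exitTime_spec hx hw hw0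
  obtain ⟨hβ', hI'⟩ := exitTime_spec hx' hw' hw0'
  set β := Ω.exitTime x w
  set x' := Ω.chartMap (repMatrix g.1) x
  set w' := fderiv ℝ (Ω.chartMap (repMatrix g.1)) x w
  set β' := Ω.exitTime x' w'
  set k := Ω.chart (repMatrix g.1 *ᵥ w) / Ω.chart (repMatrix g.1 *ᵥ x)
  by_contra hcon
  push Not at hcon
  have hc : β⁻¹ < β'⁻¹ - k := by linarith
  have hc0 : 0 < β'⁻¹ - k := lt_trans (inv_pos.2 hβ) hc
  have hs0 : 0 < (β'⁻¹ - k)⁻¹ := inv_pos.2 hc0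
  have hsβ : (β'⁻¹ - k)⁻¹ < β := inv_lt_of_inv_lt₀ hβ hc
  have hs := (hI _ hs0.le).2 hsβ
  obtain ⟨h1, h2⟩ := hl _ hs
  have h3 := chartMap_mem g hs
  rw [h2, hI' _ (by positivity), div_lt_iff₀ h1] at h3
  have : β' * (1 + k * (β'⁻¹ - k)⁻¹) = (β'⁻¹ - k)⁻¹ := by
    have hcne := hc0.ne'
    have e : (β'⁻¹ - k) * (β'⁻¹ - k)⁻¹ = 1 := mul_inv_cancel₀ hcne
    have e2 : β' * β'⁻¹ = 1 := mul_inv_cancel₀ hβ'.ne'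
    linear_combination (-β') * e + (β'⁻¹ - k)⁻¹ * e2
  linarith

theorem exitTime_act (g : Ω.aut) {x w : Fin (n + 1) → ℝ} (hx : x ∈ Ω.slice)
    (hw : Ω.chart w = 0) (hw0 : w ≠ 0) :
    (Ω.exitTime (Ω.chartMap (repMatrix g.1) x) (fderiv ℝ (Ω.chartMap (repMatrix g.1)) x w))⁻¹ =
      (Ω.exitTime x w)⁻¹ + Ω.chart (repMatrix g.1 *ᵥ w) / Ω.chart (repMatrix g.1 *ᵥ x) := by
  refine le_antisymm (exitTime_act_le g hx hw hw0) ?_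
  have hl := chart_rep_ne_zero g hx
  have h := exitTime_act_le g⁻¹ (chartMap_mem g hx) (chart_fderiv (repMatrix g.1) hl w)
    (fderiv_act_ne_zero g hx hw hw0)
  have h1 := chartMap_act_mul g⁻¹ g hx w
  rw [inv_mul_cancel, (chartMap_act_one hx hw).1, (chartMap_act_one hx hw).2] at h1
  rw [← h1.1, ← h1.2] at h
  obtain ⟨c, hc, e⟩ := repMatrix_mul (g⁻¹).1 g.1
  obtain ⟨c', hc', e'⟩ := repMatrix_one (n := n)
  have e3 : repMatrix (g⁻¹).1 * repMatrix g.1 = (c⁻¹ * c') • 1 := by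
    rw [← Subgroup.coe_mul, inv_mul_cancel, Subgroup.coe_one, e'] at e
    rw [mul_smul, e, smul_smul, inv_mul_cancel₀ hc, one_smul]
  have hd : c⁻¹ * c' ≠ 0 := mul_ne_zero (inv_ne_zero hc) hc'
  have hk : Ω.chart (repMatrix (g⁻¹).1 *ᵥ fderiv ℝ (Ω.chartMap (repMatrix g.1)) x w) /
      Ω.chart (repMatrix (g⁻¹).1 *ᵥ Ω.chartMap (repMatrix g.1) x) =
      -(Ω.chart (repMatrix g.1 *ᵥ w) / Ω.chart (repMatrix g.1 *ᵥ x)) := by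
    rw [(hasFDerivAt_chartMap _ hl).2, chartMap, Matrix.mulVec_sub]
    simp only [Matrix.mulVec_smul, Matrix.mulVec_mulVec, e3, Matrix.smul_mulVec, Matrix.one_mulVec,
      map_sub, map_smul, hx.1, hw, smul_eq_mul]
    field_simp
    ring
  rw [hk] at h
  linarith

theorem exitTime_act_neg (g : Ω.aut) {x w : Fin (n + 1) → ℝ} (hx : x ∈ Ω.slice)
    (hw : Ω.chart w = 0) (hw0 : w ≠ 0) :
    (Ω.exitTime (Ω.chartMap (repMatrix g.1) x) (-fderiv ℝ (Ω.chartMap (repMatrix g.1)) x w))⁻¹ =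
      (Ω.exitTime x (-w))⁻¹ - Ω.chart (repMatrix g.1 *ᵥ w) / Ω.chart (repMatrix g.1 *ᵥ x) := by
  have := exitTime_act g hx (w := -w) (by simp [hw]) (by simpa using hw0)
  rw [map_neg] at this
  rw [this, Matrix.mulVec_neg, map_neg, neg_div, sub_eq_add_neg]

/-- The automorphisms of `Ω` act on `Ω` by projective transformations. -/
instance actPoint (Ω : ProperlyConvexDomain n) : MulAction Ω.aut Ω.Point where
  smul g x := ⟨Ω.chartMap (repMatrix g.1) x.1, chartMap_mem g x.2⟩
  one_smul x := by
    obtain ⟨x, hx⟩ := x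
    exact Subtype.ext (chartMap_act_one (w := 0) hx (by simp)).1
  mul_smul g h x := by
    obtain ⟨x, hx⟩ := x
    exact Subtype.ext (chartMap_act_mul g h hx 0).1

/-- The automorphisms of `Ω` act on `SΩ` by the differentials of projective transformations. -/
instance actUnitTangent (Ω : ProperlyConvexDomain n) : MulAction Ω.aut Ω.UnitTangent where
  smul g v := ⟨(Ω.chartMap (repMatrix g.1) v.1.1,
      fderiv ℝ (Ω.chartMap (repMatrix g.1)) v.1.1 v.1.2), chartMap_mem g v.2.1,
      chart_fderiv _ (chart_rep_ne_zero g v.2.1) _, by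
        have hw0 := ne_zero_of_finslerNorm v.2.2.2
        have h := v.2.2.2
        rw [finslerNorm] at h ⊢
        rw [exitTime_act g v.2.1 v.2.2.1 hw0, exitTime_act_neg g v.2.1 v.2.2.1 hw0]
        linarith⟩
  one_smul v := by
    obtain ⟨⟨x, w⟩, hx, hw, hF⟩ := v
    exact Subtype.ext (Prod.ext (chartMap_act_one hx hw).1 (chartMap_act_one hx hw).2)
  mul_smul g h v := by
    obtain ⟨⟨x, w⟩, hx, hw, hF⟩ := v
    exact Subtype.ext (Prod.ext (chartMap_act_mul g h hx w).1 (chartMap_act_mul g h hx w).2)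

theorem geodesic_act (g : Ω.aut) (v : Ω.UnitTangent) (t : ℝ) :
    Ω.geodesic (g • v).1.1 (g • v).1.2 t =
      Ω.chartMap (repMatrix g.1) (Ω.geodesic v.1.1 v.1.2 t) := by
  have hmem := (flow_mem v t).1
  obtain ⟨⟨x, w⟩, hx, hw, hF⟩ := v
  have hw0 := ne_zero_of_finslerNorm hF
  change Ω.geodesic (Ω.chartMap (repMatrix g.1) x) (fderiv ℝ (Ω.chartMap (repMatrix g.1)) x w) t = _
  unfold geodesic at hmem ⊢
  obtain ⟨h1, h2⟩ := chartMap_line g hx _ hmem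
  dsimp only at hx hw hF h1 h2 hw0 ⊢
  rw [h2, exitTime_act g hx hw hw0, exitTime_act_neg g hx hw hw0]
  have hb := inv_pos.2 (exitTime_spec hx hw hw0).1
  have ha := inv_pos.2 (exitTime_spec hx (w := -w) (by simp [hw]) (by simpa using hw0)).1
  congr 2
  set a := (Ω.exitTime x (-w))⁻¹
  set b := (Ω.exitTime x w)⁻¹
  set k := Ω.chart (repMatrix g.1 *ᵥ w) / Ω.chart (repMatrix g.1 *ᵥ x)
  have hE := Real.exp_pos (2 * t)
  set E := Real.exp (2 * t)
  have hD : 0 < a + b * E := by positivity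
  have e : 1 + k * ((E - 1) / (a + b * E)) = (a - k + (b + k) * E) / (a + b * E) := by
    field_simp; ring
  rw [e]
  rw [e] at h1
  have h3 : 0 < a - k + (b + k) * E := by
    have := mul_pos h1 hD
    rwa [div_mul_cancel₀ _ hD.ne'] at this
  field_simp

theorem flow_smul (g : Ω.aut) (t : ℝ) (v : Ω.UnitTangent) :
    Ω.flow t (g • v) = g • Ω.flow t v := by
  have h1 := geodesic_act g v
  refine Subtype.ext (Prod.ext (h1 t) ?_)
  change deriv (Ω.geodesic (g • v).1.1 (g • v).1.2) t =
    fderiv ℝ (Ω.chartMap (repMatrix g.1)) (Ω.geodesic v.1.1 v.1.2 t)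
      (deriv (Ω.geodesic v.1.1 v.1.2) t)
  have h2 : Ω.geodesic (g • v).1.1 (g • v).1.2 =
      Ω.chartMap (repMatrix g.1) ∘ Ω.geodesic v.1.1 v.1.2 := funext h1
  rw [h2]
  have hd := (hasDerivAt_geodesic v t).differentiableAt.hasDerivAt
  exact ((hasFDerivAt_chartMap _ (chart_rep_ne_zero g (flow_mem v t).1)).1.comp_hasDerivAt t
    hd).deriv

/-! ### The quotient of a domain by a group of automorphisms -/

/-- The quotient `M = Ω/Γ`, with the quotient topology. -/
abbrev QuotientSpace (Γ : Subgroup Ω.aut) : Type := Quotient (MulAction.orbitRel Γ Ω.Point)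

/-- The Finsler unit tangent bundle `SM = SΩ/Γ` of `M`, with the quotient topology. -/
abbrev QuotUnitTangent (Γ : Subgroup Ω.aut) : Type :=
  Quotient (MulAction.orbitRel Γ Ω.UnitTangent)

/-- The Hilbert metric of `M = Ω/Γ`: the infimum of the Hilbert distances between lifts. -/
def quotDist (Γ : Subgroup Ω.aut) (p q : Ω.QuotientSpace Γ) : ℝ :=
  sInf {r | ∃ x y : Ω.Point, Quotient.mk _ x = p ∧ Quotient.mk _ y = q ∧
    r = Ω.hilbertDist x.1 y.1}

/-- The footpoint projection `SM → M`. -/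
def footpoint (Γ : Subgroup Ω.aut) : Ω.QuotUnitTangent Γ → Ω.QuotientSpace Γ :=
  Quotient.map (fun v => (⟨v.1.1, v.2.1⟩ : Ω.Point)) (by
    rintro v u ⟨g, rfl⟩
    exact ⟨g, rfl⟩)

/-- The geodesic flow of `M` on `SM`. -/
def geodesicFlow (Γ : Subgroup Ω.aut) (t : ℝ) : Ω.QuotUnitTangent Γ → Ω.QuotUnitTangent Γ :=
  Quotient.map (Ω.flow t) (by
    rintro v u ⟨g, rfl⟩
    exact ⟨g, (flow_smul g.1 t u).symm⟩)

end ProperlyConvexDomain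

end

/-! The Hilbert metric is read off from the open convex cone over Ω. If `dil x y` is the infimum of
the `l` with `x ≤ l y` in the order of the cone, the distance is half the logarithm of `dil x y *
dil y x` (`hilbertDist_eq`). Since `dil x y < l` just says that `l y - x` lies in the cone
(`dil_lt_iff`), most estimates amount to adding vectors of a convex cone.

The geometric heart is that two unit speed lines c, c' are controlled by their ends, without any
strict convexity or smoothness of Ω: d(c(t), c'(t)) ≤ d(c(0), c'(0)) + d(c(T), c'(T)) for 0 ≤ t ≤ T
(`coneDist_pos_le_add`). Up to scale, c(t) is e^{2t} P + Q with P and Q on the boundary rays of the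
forward and backward endpoints, so in the parameter e^{2t} both lines are affine in the cone. Each
of the two dilations is then at most the maximum of its values at the ends (`dil_segment_le`). If
the two maxima occur at opposite ends, the two factors missing from the product have product at
least 1 because P is on the boundary (`one_le_dil_mul_dil_of_boundary`).

Nontrivial elements of Γ displace points by a definite amount, say at least 3ρ. If ε-close vectors
of SM have lifts with footpoints less than ρ apart, then an orbit that stays ε-close to the orbit of
v for all t ≥ 0 has a single lift that stays ρ-close to a given lift of v (`exists_tracking_lift`).
By the inequality above, this lift is known on [0, T + 1] up to a small error once it is known which
small cells contain its points at times 0 and T + 1. By cocompactness the number of cells needed for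
a ball of radius ρ does not depend on its centre (`exists_uniform_cells`). Hence the spanning
numbers of Φ_ε(v) are bounded uniformly in T (`exists_spanningNumber_le`) and the entropy vanishes.

The two claims differ only in the choice of ρ and ε. For a general metric both come from
compactness. For a normalized metric any ρ strictly between ε and inj(M)/3 works, because nontrivial
elements of Γ displace points by at least 2 inj(M) (`injRadius_le`). -/

noncomputable section

namespace ProperlyConvexDomain

variable {n : ℕ} {Ω : ProperlyConvexDomain n}

/-! ### The cone over a properly convex domain -/

/-- The open convex cone over the slice of `Ω`. -/
def cone (Ω : ProperlyConvexDomain n) : Set (Fin (n + 1) → ℝ) :=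
  {x | 0 < Ω.chart x ∧ ∃ h : x ≠ 0, Projectivization.mk ℝ x h ∈ Ω.carrier}

theorem chart_pos {x : Fin (n + 1) → ℝ} (hx : x ∈ Ω.cone) : 0 < Ω.chart x := hx.1

theorem mem_slice_iff {x : Fin (n + 1) → ℝ} : x ∈ Ω.slice ↔ Ω.chart x = 1 ∧ x ∈ Ω.cone := by
  constructor
  · rintro ⟨h1, h2⟩
    exact ⟨h1, by rw [h1]; exact one_pos, h2⟩
  · rintro ⟨h1, h2⟩
    exact ⟨h1, h2.2⟩

theorem slice_subset_cone : Ω.slice ⊆ Ω.cone := fun _ hx => (mem_slice_iff.1 hx).2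

theorem isOpen_coneSet : IsOpen Ω.cone :=
  (isOpen_lt continuous_const Ω.chart.continuous).inter Ω.isOpen_cone

theorem mk_smul_mem {c : ℝ} (hc : c ≠ 0) {x : Fin (n + 1) → ℝ}
    (hx : ∃ h : x ≠ 0, Projectivization.mk ℝ x h ∈ Ω.carrier) :
    ∃ h : c • x ≠ 0, Projectivization.mk ℝ (c • x) h ∈ Ω.carrier := by
  obtain ⟨h, hx⟩ := hx
  refine ⟨smul_ne_zero hc h, ?_⟩
  convert hx using 1
  exact (Projectivization.mk_eq_mk_iff' ℝ _ _ _ _).2 ⟨_, rfl⟩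

theorem smul_mem_cone {c : ℝ} (hc : 0 < c) {x : Fin (n + 1) → ℝ} (hx : x ∈ Ω.cone) :
    c • x ∈ Ω.cone :=
  ⟨by simpa using mul_pos hc hx.1, mk_smul_mem hc.ne' hx.2⟩

theorem smul_mem_cone_iff {c : ℝ} (hc : 0 < c) {x : Fin (n + 1) → ℝ} :
    c • x ∈ Ω.cone ↔ x ∈ Ω.cone := by
  refine ⟨fun h => ?_, smul_mem_cone hc⟩
  simpa [smul_smul, hc.ne'] using smul_mem_cone (inv_pos.2 hc) h

theorem inv_chart_smul_mem_slice {x : Fin (n + 1) → ℝ} (hx : x ∈ Ω.cone) :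
    (Ω.chart x)⁻¹ • x ∈ Ω.slice :=
  mem_slice_iff.2 ⟨by simp [hx.1.ne'], smul_mem_cone (inv_pos.2 hx.1) hx⟩

theorem add_mem_cone {x y : Fin (n + 1) → ℝ} (hx : x ∈ Ω.cone) (hy : y ∈ Ω.cone) :
    x + y ∈ Ω.cone := by
  have hpx := chart_pos hx
  have hpy := chart_pos hy
  have hs : 0 < Ω.chart x + Ω.chart y := add_pos hpx hpy
  have h := Ω.convex (inv_chart_smul_mem_slice hx) (inv_chart_smul_mem_slice hy)
    (a := Ω.chart x / (Ω.chart x + Ω.chart y)) (b := Ω.chart y / (Ω.chart x + Ω.chart y))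
    (by positivity) (by positivity) (by field_simp)
  have h2 := smul_mem_cone hs (slice_subset_cone h)
  convert h2 using 1
  simp only [smul_add, smul_smul]
  congr 1
  · have : (Ω.chart x + Ω.chart y) * (Ω.chart x / (Ω.chart x + Ω.chart y) * (Ω.chart x)⁻¹) = 1 := by
      field_simp
    rw [this, one_smul]
  · have : (Ω.chart x + Ω.chart y) * (Ω.chart y / (Ω.chart x + Ω.chart y) * (Ω.chart y)⁻¹) = 1 := by
      field_simp
    rw [this, one_smul]

/-- Openness of the cone allows `y` to be replaced by a nearby `z` in the cone with `x + y - z`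
still in the cone. -/
theorem add_closure_mem_cone {x y : Fin (n + 1) → ℝ} (hx : x ∈ Ω.cone)
    (hy : y ∈ closure Ω.cone) : x + y ∈ Ω.cone := by
  have hc : Continuous fun z => x + y - z := by fun_prop
  have ho : IsOpen ((fun z => x + y - z) ⁻¹' Ω.cone) := isOpen_coneSet.preimage hc
  obtain ⟨z, hz1, hz2⟩ := mem_closure_iff.1 hy _ ho (by simpa using hx)
  simpa using add_mem_cone hz1 hz2

/-- Boundedness of the slice, made homogeneous. It turns inequalities in the order of the cone into
norm bounds. -/
theorem exists_norm_le_chart (Ω : ProperlyConvexDomain n) :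
    ∃ R : ℝ, 0 < R ∧ ∀ z ∈ Ω.cone, ‖z‖ ≤ R * Ω.chart z := by
  obtain ⟨R, hR⟩ := Ω.isBounded.exists_norm_le
  refine ⟨max R 1, by positivity, fun z hz => ?_⟩
  have h1 := hR _ (inv_chart_smul_mem_slice hz)
  have hp := chart_pos hz
  rw [norm_smul, norm_inv, Real.norm_of_nonneg hp.le, inv_mul_le_iff₀ hp] at h1
  calc ‖z‖ ≤ Ω.chart z * R := h1
    _ ≤ _ := by rw [mul_comm]; gcongr; exact le_max_left _ _

/-! ### The dilation of two points of the cone -/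

/-- The infimum of the `l` with `x ≤ l y` for the order of the cone. -/
def dil (Ω : ProperlyConvexDomain n) (x y : Fin (n + 1) → ℝ) : ℝ :=
  sInf {l : ℝ | l • y - x ∈ Ω.cone}

theorem chart_div_lt_of_mem {x y : Fin (n + 1) → ℝ} (hy : y ∈ Ω.cone)
    {l : ℝ} (h : l • y - x ∈ Ω.cone) : Ω.chart x / Ω.chart y < l := by
  have := chart_pos h
  rw [map_sub, map_smul, smul_eq_mul, sub_pos] at this
  rwa [div_lt_iff₀ (chart_pos hy)]

/-- The admissible `l` form an up-set because the cone is convex, and the infimum is not attained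
because the cone is open. -/
theorem dil_lt_iff {x y : Fin (n + 1) → ℝ} (hy : y ∈ Ω.cone) {l : ℝ} :
    Ω.dil x y < l ↔ l • y - x ∈ Ω.cone := by
  have hbd : BddBelow {l : ℝ | l • y - x ∈ Ω.cone} :=
    ⟨_, fun l hl => (chart_div_lt_of_mem hy hl).le⟩
  have hne : {l : ℝ | l • y - x ∈ Ω.cone}.Nonempty := by
    have hc : Continuous fun s : ℝ => y - s • x := by fun_prop
    have ho : IsOpen ((fun s : ℝ => y - s • x) ⁻¹' Ω.cone) := isOpen_coneSet.preimage hc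
    obtain ⟨ε, hε, hb⟩ := Metric.isOpen_iff.1 ho 0 (by simpa using hy)
    have h1 : y - (ε / 2) • x ∈ Ω.cone := hb (by simp [abs_of_pos hε]; linarith)
    have h2 := smul_mem_cone (c := (ε / 2)⁻¹) (by positivity) h1
    refine ⟨(ε / 2)⁻¹, ?_⟩
    rw [smul_sub, smul_smul, inv_mul_cancel₀ (by positivity), one_smul] at h2
    exact h2
  constructor
  · intro h
    obtain ⟨m, hm, hml⟩ := exists_lt_of_csInf_lt hne h
    have := add_mem_cone hm (smul_mem_cone (sub_pos.2 hml) hy)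
    convert this using 1
    module
  · intro h
    have hc : Continuous fun s : ℝ => s • y - x := by fun_prop
    have ho : IsOpen ((fun s : ℝ => s • y - x) ⁻¹' Ω.cone) := isOpen_coneSet.preimage hc
    obtain ⟨ε, hε, hb⟩ := Metric.isOpen_iff.1 ho l h
    have : l - ε / 2 ∈ {l : ℝ | l • y - x ∈ Ω.cone} := hb (by simp [abs_of_pos hε]; linarith)
    exact lt_of_le_of_lt (csInf_le hbd this) (by linarith)

theorem dil_eq_of_forall {x y : Fin (n + 1) → ℝ} (hy : y ∈ Ω.cone) {c : ℝ}
    (h : ∀ l, c < l ↔ l • y - x ∈ Ω.cone) : Ω.dil x y = c :=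
  eq_of_forall_gt_iff fun l => by rw [dil_lt_iff hy, h]

theorem chart_div_le_dil {x y : Fin (n + 1) → ℝ} (hy : y ∈ Ω.cone) :
    Ω.chart x / Ω.chart y ≤ Ω.dil x y :=
  le_of_forall_gt fun _ hl => chart_div_lt_of_mem hy ((dil_lt_iff hy).1 hl)

theorem dil_pos {x y : Fin (n + 1) → ℝ} (hx : x ∈ Ω.cone) (hy : y ∈ Ω.cone) : 0 < Ω.dil x y :=
  (div_pos (chart_pos hx) (chart_pos hy)).trans_le (chart_div_le_dil hy)

theorem one_le_dil {x y : Fin (n + 1) → ℝ} (hx : x ∈ Ω.slice) (hy : y ∈ Ω.slice) :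
    1 ≤ Ω.dil x y := by
  have := chart_div_le_dil (x := x) (slice_subset_cone hy)
  rwa [hx.1, hy.1, div_one] at this

theorem dil_self {x : Fin (n + 1) → ℝ} (hx : x ∈ Ω.cone) : Ω.dil x x = 1 := by
  refine dil_eq_of_forall hx fun l => ?_
  have e : l • x - x = (l - 1) • x := by module
  rw [e]
  constructor
  · exact fun h => smul_mem_cone (sub_pos.2 h) hx
  · intro h
    have := chart_pos h
    rw [map_smul, smul_eq_mul, mul_pos_iff_of_pos_right (chart_pos hx)] at this
    linarith

/-- Transitivity of the order: `(l / m) y - x` and `m z - y` in the cone give `l z - x` in the cone.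
-/
theorem dil_triangle {x y z : Fin (n + 1) → ℝ} (hx : x ∈ Ω.cone) (hy : y ∈ Ω.cone)
    (hz : z ∈ Ω.cone) : Ω.dil x z ≤ Ω.dil x y * Ω.dil y z := by
  have hp := dil_pos hx hy
  have hq := dil_pos hy hz
  refine le_of_forall_gt fun l hl => (dil_lt_iff hz).2 ?_
  obtain ⟨m, hm, hml⟩ : ∃ m, Ω.dil y z < m ∧ Ω.dil x y * m < l := by
    have : Ω.dil y z < l / Ω.dil x y := by rwa [lt_div_iff₀ hp, mul_comm]
    obtain ⟨m, h1, h2⟩ := exists_between this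
    exact ⟨m, h1, by rwa [lt_div_iff₀ hp, mul_comm] at h2⟩
  have hm0 := hq.trans hm
  have h2 : Ω.dil x y < l / m := by rwa [lt_div_iff₀ hm0]
  have := add_mem_cone ((dil_lt_iff hy).1 h2)
    (smul_mem_cone ((hp.trans h2)) ((dil_lt_iff hz).1 hm))
  convert this using 1
  have e : l = l / m * m := by field_simp
  nth_rewrite 1 [e]
  module

theorem dil_smul_left {x y : Fin (n + 1) → ℝ} (hy : y ∈ Ω.cone) {c : ℝ} (hc : 0 < c) :
    Ω.dil (c • x) y = c * Ω.dil x y := by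
  refine dil_eq_of_forall hy fun l => ?_
  have : l • y - c • x = c • ((l / c) • y - x) := by
    rw [smul_sub, smul_smul, mul_div_cancel₀ _ hc.ne']
  rw [this, smul_mem_cone_iff hc, ← dil_lt_iff hy, lt_div_iff₀ hc, mul_comm]

theorem dil_smul_right {x y : Fin (n + 1) → ℝ} (hy : y ∈ Ω.cone) {c : ℝ} (hc : 0 < c) :
    Ω.dil x (c • y) = c⁻¹ * Ω.dil x y := by
  refine dil_eq_of_forall (smul_mem_cone hc hy) fun l => ?_
  rw [smul_smul, ← dil_lt_iff hy, inv_mul_lt_iff₀ hc, mul_comm]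

/-- The Hilbert distance on the cone. -/
def coneDist (Ω : ProperlyConvexDomain n) (x y : Fin (n + 1) → ℝ) : ℝ :=
  1 / 2 * Real.log (Ω.dil x y * Ω.dil y x)

theorem one_le_dil_mul_dil {x y : Fin (n + 1) → ℝ} (hx : x ∈ Ω.cone) (hy : y ∈ Ω.cone) :
    1 ≤ Ω.dil x y * Ω.dil y x :=
  (dil_self hx).symm.trans_le (dil_triangle hx hy hx)

theorem coneDist_nonneg {x y : Fin (n + 1) → ℝ} (hx : x ∈ Ω.cone) (hy : y ∈ Ω.cone) :
    0 ≤ Ω.coneDist x y :=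
  mul_nonneg (by norm_num) (Real.log_nonneg (one_le_dil_mul_dil hx hy))

theorem coneDist_comm (x y : Fin (n + 1) → ℝ) : Ω.coneDist x y = Ω.coneDist y x := by
  rw [coneDist, coneDist, mul_comm (Ω.dil x y)]

theorem coneDist_self {x : Fin (n + 1) → ℝ} (hx : x ∈ Ω.cone) : Ω.coneDist x x = 0 := by
  simp [coneDist, dil_self hx]

theorem coneDist_triangle {x y z : Fin (n + 1) → ℝ} (hx : x ∈ Ω.cone) (hy : y ∈ Ω.cone)
    (hz : z ∈ Ω.cone) : Ω.coneDist x z ≤ Ω.coneDist x y + Ω.coneDist y z := by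
  have h1 := dil_pos hx hy
  have h2 := dil_pos hy hx
  have h3 := dil_pos hy hz
  have h4 := dil_pos hz hy
  have h5 := dil_pos hx hz
  have h6 := dil_pos hz hx
  rw [coneDist, coneDist, coneDist, ← mul_add, ← Real.log_mul (by positivity) (by positivity)]
  have : Ω.dil x z * Ω.dil z x ≤ Ω.dil x y * Ω.dil y x * (Ω.dil y z * Ω.dil z y) := by
    calc _ ≤ (Ω.dil x y * Ω.dil y z) * (Ω.dil z y * Ω.dil y x) :=
          mul_le_mul (dil_triangle hx hy hz) (dil_triangle hz hy hx) h6.le (by positivity)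
      _ = _ := by ring
  gcongr

theorem coneDist_smul {x y : Fin (n + 1) → ℝ} (hx : x ∈ Ω.cone) (hy : y ∈ Ω.cone) {c c' : ℝ}
    (hc : 0 < c) (hc' : 0 < c') : Ω.coneDist (c • x) (c' • y) = Ω.coneDist x y := by
  rw [coneDist, coneDist, dil_smul_left (smul_mem_cone hc' hy) hc, dil_smul_right hy hc',
    dil_smul_left (smul_mem_cone hc hx) hc', dil_smul_right hx hc]
  congr 2
  field_simp

/-! ### Lines -/

theorem add_smul_mem_cone_iff {x w : Fin (n + 1) → ℝ} (hx : x ∈ Ω.slice) (hw : Ω.chart w = 0)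
    {c : ℝ} (hc : 0 < c) (s : ℝ) : c • x + s • w ∈ Ω.cone ↔ x + (s / c) • w ∈ Ω.slice := by
  have e : c • x + s • w = c • (x + (s / c) • w) := by
    rw [smul_add, smul_smul, mul_div_cancel₀ _ hc.ne']
  rw [e, smul_mem_cone_iff hc, mem_slice_iff]
  simp [hx.1, hw]

theorem inv_exitTime_pos {x w : Fin (n + 1) → ℝ} (hx : x ∈ Ω.slice) (hw : Ω.chart w = 0)
    (hw0 : w ≠ 0) : 0 < (Ω.exitTime x w)⁻¹ :=
  inv_pos.2 (exitTime_spec hx hw hw0).1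

theorem inv_exitTime_neg_pos {x w : Fin (n + 1) → ℝ} (hx : x ∈ Ω.slice) (hw : Ω.chart w = 0)
    (hw0 : w ≠ 0) : 0 < (Ω.exitTime x (-w))⁻¹ :=
  inv_exitTime_pos hx (by simp [hw]) (by simpa using hw0)

theorem line_mem_iff_inv {x w : Fin (n + 1) → ℝ} (hx : x ∈ Ω.slice) (hw : Ω.chart w = 0)
    (hw0 : w ≠ 0) (s : ℝ) : x + s • w ∈ Ω.slice ↔
      0 < 1 + (Ω.exitTime x (-w))⁻¹ * s ∧ 0 < 1 - (Ω.exitTime x w)⁻¹ * s := by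
  have ha := inv_exitTime_neg_pos hx hw hw0
  have hb := inv_exitTime_pos hx hw hw0
  have ha' := inv_pos.1 ha
  have hb' := inv_pos.1 hb
  rw [line_mem_iff hx hw hw0, inv_mul_eq_div, inv_mul_eq_div]
  have e1 : 1 + s / Ω.exitTime x (-w) = (s + Ω.exitTime x (-w)) / Ω.exitTime x (-w) := by
    field_simp; ring
  have e2 : 1 - s / Ω.exitTime x w = (Ω.exitTime x w - s) / Ω.exitTime x w := by
    field_simp
  rw [e1, e2, div_pos_iff_of_pos_right ha', div_pos_iff_of_pos_right hb']
  constructor <;> rintro ⟨h1, h2⟩ <;> constructor <;> linarith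

/-- The reciprocal exit time is a gauge in `w`, and this form yields its continuity and homogeneity.
The case `w = 0` is included: the `sSup` of all of ℝ is 0, and so is its inverse. -/
theorem inv_exitTime_lt_iff {x w : Fin (n + 1) → ℝ} (hx : x ∈ Ω.slice) (hw : Ω.chart w = 0)
    {c : ℝ} : (Ω.exitTime x w)⁻¹ < c ↔ c • x + w ∈ Ω.cone := by
  rcases le_or_gt c 0 with hc | hc
  · refine iff_of_false ?_ ?_
    · rw [not_lt]
      rcases eq_or_ne w 0 with rfl | hw0
      · simpa [exitTime, hx] using hc
      · exact hc.trans (inv_exitTime_pos hx hw hw0).le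
    · intro h
      have := chart_pos h
      simp [hx.1, hw] at this
      linarith
  rcases eq_or_ne w 0 with rfl | hw0
  · refine iff_of_true (by simpa [exitTime, hx] using hc) ?_
    simpa using smul_mem_cone hc (slice_subset_cone hx)
  have h := add_smul_mem_cone_iff hx hw hc 1
  rw [one_smul] at h
  rw [h, line_mem_iff_inv hx hw hw0]
  have ha := inv_exitTime_neg_pos hx hw hw0
  have e2 : 1 - (Ω.exitTime x w)⁻¹ * (1 / c) = (c - (Ω.exitTime x w)⁻¹) / c := by
    field_simp
  rw [e2, div_pos_iff_of_pos_right hc, sub_pos]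
  exact ⟨fun h => ⟨by positivity, h⟩, fun h => h.2⟩

/-- In the plane of `x` and `w` the cone is bounded by two rays, and each dilation is decided by one
of them alone: the first by the forward endpoint, the second by the backward one. -/
theorem dil_line {x w : Fin (n + 1) → ℝ} (hx : x ∈ Ω.slice) (hw : Ω.chart w = 0)
    (hw0 : w ≠ 0) {s r : ℝ} (hs : x + s • w ∈ Ω.slice) (hr : x + r • w ∈ Ω.slice) (hsr : s ≤ r) :
    Ω.dil (x + s • w) (x + r • w) =
        (1 - (Ω.exitTime x w)⁻¹ * s) / (1 - (Ω.exitTime x w)⁻¹ * r) ∧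
    Ω.dil (x + r • w) (x + s • w) =
        (1 + (Ω.exitTime x (-w))⁻¹ * r) / (1 + (Ω.exitTime x (-w))⁻¹ * s) := by
  have ha := inv_exitTime_neg_pos hx hw hw0
  have hb := inv_exitTime_pos hx hw hw0
  have hl := line_mem_iff_inv hx hw hw0
  obtain ⟨s1, s2⟩ := (hl s).1 hs
  obtain ⟨r1, r2⟩ := (hl r).1 hr
  set a := (Ω.exitTime x (-w))⁻¹
  set b := (Ω.exitTime x w)⁻¹
  have hrs : 0 ≤ r - s := by linarith
  constructor
  · refine dil_eq_of_forall (slice_subset_cone hr) fun l => ?_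
    have e : l • (x + r • w) - (x + s • w) = (l - 1) • x + (l * r - s) • w := by module
    rw [e, div_lt_iff₀ r2]
    constructor
    · intro h
      have h0 : b * (r - s) < (l - 1) * (1 - b * r) := by linarith
      have h1 : 0 < l - 1 := pos_of_mul_pos_left (lt_of_le_of_lt (by positivity) h0) r2.le
      rw [add_smul_mem_cone_iff hx hw h1, hl]
      constructor
      · have : 1 + a * ((l * r - s) / (l - 1)) = ((l - 1) * (1 + a * r) + a * (r - s)) / (l - 1) := by
          field_simp; ring
        rw [this]; positivity
      · have : 1 - b * ((l * r - s) / (l - 1)) = (l * (1 - b * r) - (1 - b * s)) / (l - 1) := by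
          field_simp; ring
        rw [this]; exact div_pos (by linarith) h1
    · intro h
      have h1 : 0 < l - 1 := by
        have := chart_pos h
        simpa [hx.1, hw] using this
      rw [add_smul_mem_cone_iff hx hw h1, hl] at h
      have : 1 - b * ((l * r - s) / (l - 1)) = (l * (1 - b * r) - (1 - b * s)) / (l - 1) := by
        field_simp; ring
      rw [this, div_pos_iff_of_pos_right h1] at h
      linarith
  · refine dil_eq_of_forall (slice_subset_cone hs) fun l => ?_
    have e : l • (x + s • w) - (x + r • w) = (l - 1) • x + (l * s - r) • w := by module
    rw [e, div_lt_iff₀ s1]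
    have e2 : ∀ h1 : 0 < l - 1,
        1 + a * ((l * s - r) / (l - 1)) = (l * (1 + a * s) - (1 + a * r)) / (l - 1) := by
      intro h1; field_simp; ring
    constructor
    · intro h
      have h0 : a * (r - s) < (l - 1) * (1 + a * s) := by linarith
      have h1 : 0 < l - 1 := pos_of_mul_pos_left (lt_of_le_of_lt (by positivity) h0) s1.le
      rw [add_smul_mem_cone_iff hx hw h1, hl]
      constructor
      · rw [e2 h1]; exact div_pos (by linarith) h1
      · have : 1 - b * ((l * s - r) / (l - 1)) = ((l - 1) * (1 - b * s) + b * (r - s)) / (l - 1) := by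
          field_simp; ring
        rw [this]; positivity
    · intro h
      have h1 : 0 < l - 1 := by
        have := chart_pos h
        simpa [hx.1, hw] using this
      rw [add_smul_mem_cone_iff hx hw h1, hl, e2 h1, div_pos_iff_of_pos_right h1] at h
      linarith

/-- The oriented Hilbert length along a line. -/
def linePos (Ω : ProperlyConvexDomain n) (x w : Fin (n + 1) → ℝ) (s : ℝ) : ℝ :=
  1 / 2 * (Real.log (1 + (Ω.exitTime x (-w))⁻¹ * s) - Real.log (1 - (Ω.exitTime x w)⁻¹ * s))

theorem coneDist_line {x w : Fin (n + 1) → ℝ} (hx : x ∈ Ω.slice) (hw : Ω.chart w = 0)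
    (hw0 : w ≠ 0) {s r : ℝ} (hs : x + s • w ∈ Ω.slice) (hr : x + r • w ∈ Ω.slice) (hsr : s ≤ r) :
    Ω.coneDist (x + s • w) (x + r • w) = Ω.linePos x w r - Ω.linePos x w s := by
  obtain ⟨h1, h2⟩ := dil_line hx hw hw0 hs hr hsr
  have hl := line_mem_iff_inv hx hw hw0
  obtain ⟨s1, s2⟩ := (hl s).1 hs
  obtain ⟨r1, r2⟩ := (hl r).1 hr
  rw [coneDist, h1, h2, Real.log_mul (by positivity) (by positivity), Real.log_div s2.ne' r2.ne',
    Real.log_div r1.ne' s1.ne', linePos, linePos]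
  ring

/-- The two quotients in the cross ratio are the two dilations along the line. Both are at least 1,
so the absolute value is harmless. -/
theorem hilbertDist_eq {x y : Fin (n + 1) → ℝ} (hx : x ∈ Ω.slice) (hy : y ∈ Ω.slice) :
    Ω.hilbertDist x y = Ω.coneDist x y := by
  rcases eq_or_ne x y with rfl | hxy
  · rw [coneDist_self (slice_subset_cone hx)]
    simp [hilbertDist, endpoint]
  have hw : Ω.chart (y - x) = 0 := by simp [hx.1, hy.1]
  have hw0 : y - x ≠ 0 := sub_ne_zero.2 hxy.symm
  have e0 : x + (0 : ℝ) • (y - x) = x := by simp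
  have e1 : x + (1 : ℝ) • (y - x) = y := by simp
  have h := dil_line hx hw hw0 (s := 0) (r := 1) (by rwa [e0]) (by rwa [e1]) zero_le_one
  have hm := (line_mem_iff_inv hx hw hw0 1).1 (by rwa [e1])
  rw [e0, e1] at h
  have ha := inv_exitTime_neg_pos hx hw hw0
  have hb := inv_exitTime_pos hx hw hw0
  have hn : 0 < ‖y - x‖ := norm_pos_iff.2 hw0
  have h1 : dist (Ω.endpoint x (x - y)) x = Ω.exitTime x (-(y - x)) * ‖y - x‖ := by
    rw [dist_eq_norm, endpoint, neg_sub, add_sub_cancel_left, norm_smul, norm_sub_rev,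
      Real.norm_of_nonneg]
    rw [← neg_sub y x]; exact (inv_pos.1 ha).le
  have h2 : dist (Ω.endpoint x (x - y)) y = (1 + Ω.exitTime x (-(y - x))) * ‖y - x‖ := by
    have : Ω.endpoint x (x - y) - y = -((1 + Ω.exitTime x (-(y - x))) • (y - x)) := by
      rw [endpoint, neg_sub]; module
    rw [dist_eq_norm, this, norm_neg, norm_smul, Real.norm_of_nonneg]
    have := (inv_pos.1 ha).le
    positivity
  have h3 : dist (Ω.endpoint x (y - x)) x = Ω.exitTime x (y - x) * ‖y - x‖ := by
    rw [dist_eq_norm, endpoint, add_sub_cancel_left, norm_smul, Real.norm_of_nonneg]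
    exact (inv_pos.1 hb).le
  have h5 : 1 < Ω.exitTime x (y - x) := by
    have := hm.2
    rw [mul_one, sub_pos] at this
    rwa [inv_lt_one₀ (inv_pos.1 hb)] at this
  have h4 : dist (Ω.endpoint x (y - x)) y = (Ω.exitTime x (y - x) - 1) * ‖y - x‖ := by
    have : Ω.endpoint x (y - x) - y = (Ω.exitTime x (y - x) - 1) • (y - x) := by
      rw [endpoint]; module
    rw [dist_eq_norm, this, norm_smul, Real.norm_of_nonneg (by linarith)]
  have ha' := inv_pos.1 ha
  have hb' := inv_pos.1 hb
  have h6 : Ω.exitTime x (y - x) - 1 ≠ 0 := by linarith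
  have h7 : Ω.exitTime x (x - y) = Ω.exitTime x (-(y - x)) := by rw [neg_sub]
  rw [coneDist, hilbertDist]
  rw [h1, h2, h3, h4, abs_of_nonneg, h.1, h.2]
  · congr 2
    field_simp
    simp
    ring
  · apply Real.log_nonneg
    rw [mul_div_mul_right _ _ hn.ne', mul_div_mul_right _ _ hn.ne']
    have q1 : 1 ≤ (1 + Ω.exitTime x (-(y - x))) / Ω.exitTime x (-(y - x)) := by
      rw [le_div_iff₀ ha']; linarith
    have q2 : 1 ≤ Ω.exitTime x (y - x) / (Ω.exitTime x (y - x) - 1) := by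
      rw [le_div_iff₀ (by linarith)]; linarith
    exact one_le_mul_of_one_le_of_one_le q1 q2

/-! ### Topology of the Hilbert distance -/

theorem eventually_coneDist_lt {x : Fin (n + 1) → ℝ} (hx : x ∈ Ω.cone) {e : ℝ} (he : 0 < e) :
    ∀ᶠ y in 𝓝 x, y ∈ Ω.cone ∧ Ω.coneDist x y < e := by
  have h1 : 1 < Real.exp e := Real.one_lt_exp_iff.2 he
  have hm : Real.exp e • x - x ∈ Ω.cone := by
    have := smul_mem_cone (sub_pos.2 h1) hx
    rwa [sub_smul, one_smul] at this
  have c1 : ContinuousAt (fun y => Real.exp e • y - x) x := by fun_prop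
  have c2 : ContinuousAt (fun y => Real.exp e • x - y) x := by fun_prop
  filter_upwards [isOpen_coneSet.mem_nhds hx, c1.eventually (isOpen_coneSet.mem_nhds hm),
    c2.eventually (isOpen_coneSet.mem_nhds hm)] with y hy h2 h3
  refine ⟨hy, ?_⟩
  replace h2 := (dil_lt_iff hy).2 h2
  replace h3 := (dil_lt_iff hx).2 h3
  have p1 := dil_pos hx hy
  have p2 := dil_pos hy hx
  have := Real.log_lt_log p1 h2
  have := Real.log_lt_log p2 h3
  rw [Real.log_exp] at *
  rw [coneDist, Real.log_mul p1.ne' p2.ne']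
  linarith

theorem continuousOn_coneDist :
    ContinuousOn (fun p : (Fin (n + 1) → ℝ) × (Fin (n + 1) → ℝ) => Ω.coneDist p.1 p.2)
      (Ω.cone ×ˢ Ω.cone) := by
  rintro ⟨x, y⟩ ⟨hx, hy⟩
  dsimp only at hx hy
  refine ContinuousAt.continuousWithinAt (Metric.tendsto_nhds.2 fun e he => ?_)
  have h1 := eventually_coneDist_lt hx (half_pos he)
  have h2 := eventually_coneDist_lt hy (half_pos he)
  rw [nhds_prod_eq]
  filter_upwards [h1.prod_mk h2] with p hp
  obtain ⟨⟨p1, p2⟩, p3, p4⟩ := hp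
  have t1 := coneDist_triangle hx p1 hy
  have t2 := coneDist_triangle p1 p3 hy
  have t3 := coneDist_triangle p1 hx p3
  have t4 := coneDist_triangle hx hy p3
  rw [coneDist_comm p.1 x] at t3
  rw [coneDist_comm p.2 y] at t2
  rw [Real.dist_eq, abs_lt]
  constructor <;> linarith

theorem continuous_coneDist {X : Type*} [TopologicalSpace X] {f g : X → Fin (n + 1) → ℝ}
    (hf : Continuous f) (hg : Continuous g) (hfm : ∀ x, f x ∈ Ω.cone) (hgm : ∀ x, g x ∈ Ω.cone) :
    Continuous fun x => Ω.coneDist (f x) (g x) := by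
  have h := ContinuousOn.comp_continuous (continuousOn_coneDist (Ω := Ω)) (hf.prodMk hg)
    fun x => ⟨hfm x, hgm x⟩
  simpa only [Function.comp_def] using h

/-- On the slice both dilations are at least 1, so each is at most their product. -/
theorem dil_le_exp {x y : Fin (n + 1) → ℝ} (hx : x ∈ Ω.slice) (hy : y ∈ Ω.slice) :
    Ω.dil x y ≤ Real.exp (2 * Ω.coneDist x y) := by
  have h1 := one_le_dil hx hy
  have h2 := one_le_dil hy hx
  have e : 2 * Ω.coneDist x y = Real.log (Ω.dil x y * Ω.dil y x) := by rw [coneDist]; ring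
  rw [e, Real.exp_log (by positivity)]
  nlinarith

/-- For `l` above `dil x y`, write `x - y = (l - 1) y - (l y - x)`. Both terms have chart value `l -
1` and are bounded by `exists_norm_le_chart`. -/
theorem exists_norm_sub_le (Ω : ProperlyConvexDomain n) : ∃ R : ℝ, 0 < R ∧
    ∀ x ∈ Ω.slice, ∀ y ∈ Ω.slice, ‖x - y‖ ≤ R * (Real.exp (2 * Ω.coneDist x y) - 1) := by
  obtain ⟨R, hR, h⟩ := exists_norm_le_chart Ω
  refine ⟨2 * R, by positivity, fun x hx y hy => ?_⟩
  refine le_of_forall_pos_le_add fun e he => ?_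
  have hl : Ω.dil x y < Real.exp (2 * Ω.coneDist x y) + e / (2 * R) :=
    lt_of_le_of_lt (dil_le_exp hx hy) (by linarith [show 0 < e / (2 * R) by positivity])
  set l := Real.exp (2 * Ω.coneDist x y) + e / (2 * R) with hl'
  have h1 := h _ ((dil_lt_iff (slice_subset_cone hy)).1 hl)
  have h2 := h _ (slice_subset_cone hy)
  rw [hy.1] at h2
  have h3 : 1 ≤ l := (one_le_dil hx hy).trans hl.le
  rw [map_sub, map_smul, hx.1, hy.1, smul_eq_mul, mul_one] at h1
  have e1 : x - y = (l - 1) • y - (l • y - x) := by module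
  rw [e1]
  have h4 : (l - 1) * ‖y‖ ≤ (l - 1) * (R * 1) := by gcongr
  calc _ ≤ ‖(l - 1) • y‖ + ‖l • y - x‖ := norm_sub_le _ _
    _ ≤ (l - 1) * (R * 1) + R * (l - 1) := by
      rw [norm_smul, Real.norm_of_nonneg (by linarith)]
      exact add_le_add h4 h1
    _ = 2 * R * (Real.exp (2 * Ω.coneDist x y) - 1) + e := by
      rw [hl']; field_simp; ring

theorem eq_of_coneDist_eq_zero {x y : Fin (n + 1) → ℝ} (hx : x ∈ Ω.slice) (hy : y ∈ Ω.slice)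
    (h : Ω.coneDist x y = 0) : x = y := by
  obtain ⟨R, -, hR⟩ := exists_norm_sub_le Ω
  have := hR x hx y hy
  rw [h] at this
  simpa [sub_eq_zero] using this

/-- Closed neighbourhoods of compact sets in `Ω` are relatively compact in `Ω`. -/
theorem exists_isCompact_nhds {K : Set (Fin (n + 1) → ℝ)} (hK : IsCompact K) (hKs : K ⊆ Ω.slice)
    (r : ℝ) : ∃ N, IsCompact N ∧ N ⊆ Ω.slice ∧
      ∀ x ∈ K, ∀ y ∈ Ω.slice, Ω.coneDist x y ≤ r → y ∈ N := by
  obtain ⟨R, hR, h⟩ := exists_norm_le_chart Ω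
  set l := Real.exp (2 * r) + 1
  have hl : 0 < l := by positivity
  -- Asking only for the closed cone makes `Z` compact. Still `l y = x + (l y - x)` lands in the
  -- open cone, so no limit escapes to the boundary. The `+ 1` in `l` supplies the strict inequality
  -- that `dil_lt_iff` needs.
  set Z : Set ((Fin (n + 1) → ℝ) × (Fin (n + 1) → ℝ)) :=
    (K ×ˢ Metric.closedBall 0 R) ∩ {p | Ω.chart p.2 = 1 ∧ l • p.2 - p.1 ∈ closure Ω.cone}
  have hZ : IsCompact Z := by
    refine (hK.prod (isCompact_closedBall 0 R)).inter_right (IsClosed.inter ?_ ?_)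
    · exact isClosed_eq (by fun_prop) continuous_const
    · exact isClosed_closure.preimage (by fun_prop)
  refine ⟨Prod.snd '' Z, hZ.image continuous_snd, ?_, fun x hx y hy hxy => ?_⟩
  · rintro _ ⟨⟨x, y⟩, ⟨⟨hx, -⟩, hy, hc⟩, rfl⟩
    dsimp only at *
    refine mem_slice_iff.2 ⟨hy, (smul_mem_cone_iff hl).1 ?_⟩
    simpa using add_closure_mem_cone (slice_subset_cone (hKs hx)) hc
  · refine ⟨(x, y), ⟨⟨hx, ?_⟩, hy.1, subset_closure ?_⟩, rfl⟩
    · simpa [hy.1] using h y (slice_subset_cone hy)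
    · rw [← dil_lt_iff (slice_subset_cone hy)]
      have := dil_le_exp (hKs hx) hy
      have h2 : Real.exp (2 * Ω.coneDist x y) ≤ Real.exp (2 * r) := by gcongr
      simp only [l]
      linarith

/-! ### Exit times -/

theorem continuousOn_inv_exitTime :
    ContinuousOn (fun p : (Fin (n + 1) → ℝ) × (Fin (n + 1) → ℝ) => (Ω.exitTime p.1 p.2)⁻¹)
      {p | p.1 ∈ Ω.slice ∧ Ω.chart p.2 = 0} := by
  rintro ⟨x, w⟩ ⟨hx, hw⟩
  dsimp only at hx hw
  refine tendsto_order.2 ⟨fun c hc => ?_, fun c hc => ?_⟩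
  · obtain ⟨c', hc1, hc2⟩ := exists_between hc
    -- Below the reciprocal exit time the vector avoids even the closed cone, which is an open
    -- condition on the pair.
    have h1 : c' • x + w ∉ closure Ω.cone := by
      intro hcl
      obtain ⟨c'', hc3, hc4⟩ := exists_between hc2
      have := add_closure_mem_cone (smul_mem_cone (sub_pos.2 hc3) (slice_subset_cone hx)) hcl
      have e : (c'' - c') • x + (c' • x + w) = c'' • x + w := by module
      rw [e, ← inv_exitTime_lt_iff hx hw] at this
      exact lt_asymm this hc4
    have h2 : ContinuousAt (fun p : (Fin (n + 1) → ℝ) × (Fin (n + 1) → ℝ) =>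
      c' • p.1 + p.2) (x, w) := by fun_prop
    filter_upwards [self_mem_nhdsWithin,
      nhdsWithin_le_nhds (h2.eventually (isClosed_closure.isOpen_compl.mem_nhds h1))] with p hp hp2
    refine hc1.trans_le (not_lt.1 fun hlt => hp2 (subset_closure ?_))
    exact (inv_exitTime_lt_iff hp.1 hp.2).1 hlt
  · have h1 := (inv_exitTime_lt_iff hx hw).1 hc
    have h2 : ContinuousAt (fun p : (Fin (n + 1) → ℝ) × (Fin (n + 1) → ℝ) =>
      c • p.1 + p.2) (x, w) := by fun_prop
    filter_upwards [self_mem_nhdsWithin,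
      nhdsWithin_le_nhds (h2.eventually (isOpen_coneSet.mem_nhds h1))] with p hp hp2
    exact (inv_exitTime_lt_iff hp.1 hp.2).2 hp2

theorem continuousOn_inv_exitTime_neg :
    ContinuousOn (fun p : (Fin (n + 1) → ℝ) × (Fin (n + 1) → ℝ) => (Ω.exitTime p.1 (-p.2))⁻¹)
      {p | p.1 ∈ Ω.slice ∧ Ω.chart p.2 = 0} := by
  have h : Continuous fun p : (Fin (n + 1) → ℝ) × (Fin (n + 1) → ℝ) => (p.1, -p.2) :=
    continuous_fst.prodMk continuous_snd.neg
  intro p hp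
  have hp' : Ω.chart (-p.2) = 0 := by rw [map_neg, hp.2, neg_zero]
  have h1 := continuousOn_inv_exitTime (Ω := Ω) (p.1, -p.2) ⟨hp.1, hp'⟩
  have h2 : Tendsto (fun p : (Fin (n + 1) → ℝ) × (Fin (n + 1) → ℝ) => (p.1, -p.2))
      (𝓝[{p | p.1 ∈ Ω.slice ∧ Ω.chart p.2 = 0}] p)
      (𝓝[{p | p.1 ∈ Ω.slice ∧ Ω.chart p.2 = 0}] (p.1, -p.2)) := by
    refine tendsto_nhdsWithin_iff.2 ⟨h.continuousWithinAt, ?_⟩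
    filter_upwards [self_mem_nhdsWithin] with q hq
    refine ⟨hq.1, ?_⟩
    rw [map_neg, hq.2, neg_zero]
  have h3 := h1.tendsto.comp h2
  rw [ContinuousWithinAt]
  simpa only [Function.comp_def] using h3

theorem inv_exitTime_smul {x w : Fin (n + 1) → ℝ} (hx : x ∈ Ω.slice) (hw : Ω.chart w = 0) {c : ℝ}
    (hc : 0 < c) : (Ω.exitTime x (c • w))⁻¹ = c * (Ω.exitTime x w)⁻¹ := by
  refine eq_of_forall_gt_iff fun l => ?_
  have e : l • x + c • w = c • ((l / c) • x + w) := by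
    rw [smul_add, smul_smul, mul_div_cancel₀ _ hc.ne']
  rw [inv_exitTime_lt_iff hx (by simp [hw]), e, smul_mem_cone_iff hc, ← inv_exitTime_lt_iff hx hw,
    lt_div_iff₀ hc, mul_comm]

theorem exitTime_add_smul {x w : Fin (n + 1) → ℝ} (hx : x ∈ Ω.slice) (hw : Ω.chart w = 0)
    (hw0 : w ≠ 0) {s : ℝ} (hs : x + s • w ∈ Ω.slice) :
    Ω.exitTime (x + s • w) w = Ω.exitTime x w - s ∧
      Ω.exitTime (x + s • w) (-w) = Ω.exitTime x (-w) + s := by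
  have h := line_mem_iff hx hw hw0
  have := (h s).1 hs
  refine exitTime_eq (by linarith) (by linarith) fun r => ?_
  rw [add_assoc, ← add_smul, h]
  constructor <;> rintro ⟨h1, h2⟩ <;> constructor <;> linarith

/-! ### The unit tangent bundle -/

namespace UnitTangent

theorem inv_fwd_pos (v : Ω.UnitTangent) : 0 < (Ω.exitTime v.1.1 v.1.2)⁻¹ :=
  inv_exitTime_pos v.2.1 v.2.2.1 (ne_zero_of_finslerNorm v.2.2.2)

theorem inv_bwd_pos (v : Ω.UnitTangent) : 0 < (Ω.exitTime v.1.1 (-v.1.2))⁻¹ :=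
  inv_exitTime_neg_pos v.2.1 v.2.2.1 (ne_zero_of_finslerNorm v.2.2.2)

theorem inv_add_inv (v : Ω.UnitTangent) :
    (Ω.exitTime v.1.1 v.1.2)⁻¹ + (Ω.exitTime v.1.1 (-v.1.2))⁻¹ = 2 := by
  have := v.2.2.2
  rw [finslerNorm] at this
  linarith

/-- The point at time `t` of the geodesic with initial vector `v`. -/
def pos (v : Ω.UnitTangent) (t : ℝ) : Fin (n + 1) → ℝ := Ω.geodesic v.1.1 v.1.2 t

theorem pos_mem (v : Ω.UnitTangent) (t : ℝ) : v.pos t ∈ Ω.slice := (flow_mem v t).1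

theorem pos_mem_cone (v : Ω.UnitTangent) (t : ℝ) : v.pos t ∈ Ω.cone :=
  slice_subset_cone (v.pos_mem t)

theorem pos_zero (v : Ω.UnitTangent) : v.pos 0 = v.1.1 := by simp [pos, geodesic]

theorem continuous_inv_fwd :
    Continuous fun v : Ω.UnitTangent => (Ω.exitTime v.1.1 v.1.2)⁻¹ :=
  continuousOn_inv_exitTime.comp_continuous continuous_subtype_val fun v => ⟨v.2.1, v.2.2.1⟩

theorem continuous_inv_bwd :
    Continuous fun v : Ω.UnitTangent => (Ω.exitTime v.1.1 (-v.1.2))⁻¹ :=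
  continuousOn_inv_exitTime_neg.comp_continuous continuous_subtype_val fun v => ⟨v.2.1, v.2.2.1⟩

theorem continuous_pos (t : ℝ) : Continuous fun v : Ω.UnitTangent => v.pos t := by
  unfold pos geodesic
  have h1 := continuous_inv_fwd (Ω := Ω)
  have h2 := continuous_inv_bwd (Ω := Ω)
  have h3 : Continuous fun v : Ω.UnitTangent => v.1.1 := continuous_fst.comp continuous_subtype_val
  have h4 : Continuous fun v : Ω.UnitTangent => v.1.2 := continuous_snd.comp continuous_subtype_val
  refine h3.add (Continuous.fun_smul ?_ h4)
  refine continuous_const.div (h2.add (h1.mul continuous_const)) fun v => ?_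
  have := v.inv_fwd_pos
  have := v.inv_bwd_pos
  have := Real.exp_pos (2 * t)
  positivity

/-- For Finsler unit vectors the two reciprocal exit times add up to 2, so the forward one is below
2 and `2 x + w` lies in the cone. This gives ‖w‖ ≤ 4R, within the ball of radius 6R. -/
theorem isCompact_preimage {K : Set (Fin (n + 1) → ℝ)} (hK : IsCompact K) (hKs : K ⊆ Ω.slice) :
    IsCompact {v : Ω.UnitTangent | v.1.1 ∈ K} := by
  obtain ⟨R, hR, hbd⟩ := exists_norm_le_chart Ω
  set B : Set ((Fin (n + 1) → ℝ) × (Fin (n + 1) → ℝ)) :=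
    K ×ˢ (Metric.closedBall 0 (6 * R) ∩ {w | Ω.chart w = 0})
  have hB : IsCompact B := hK.prod ((isCompact_closedBall _ _).inter_right
    (isClosed_eq Ω.chart.continuous continuous_const))
  have hF : ContinuousOn (fun p : (Fin (n + 1) → ℝ) × (Fin (n + 1) → ℝ) =>
      Ω.finslerNorm p.1 p.2) B := by
    unfold finslerNorm
    have hs : B ⊆ {p | p.1 ∈ Ω.slice ∧ Ω.chart p.2 = 0} := fun p hp => ⟨hKs hp.1, hp.2.2⟩
    exact continuousOn_const.mul ((continuousOn_inv_exitTime.mono hs).add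
      (continuousOn_inv_exitTime_neg.mono hs))
  rw [Subtype.isCompact_iff]
  have hc := hB.of_isClosed_subset
    (hF.preimage_isClosed_of_isClosed hB.isClosed (isClosed_singleton (x := (1 : ℝ))))
    inter_subset_left
  convert hc using 1
  ext ⟨x, w⟩
  constructor
  · rintro ⟨v, hv, hvx⟩
    obtain ⟨⟨x', w'⟩, hx, hw, hF⟩ := v
    cases hvx
    refine ⟨⟨hv, ?_, hw⟩, hF⟩
    have h1 := inv_add_inv ⟨(x, w), hx, hw, hF⟩
    have h2 := inv_bwd_pos ⟨(x, w), hx, hw, hF⟩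
    dsimp only at *
    have h3 : (Ω.exitTime x w)⁻¹ < 2 := by linarith
    have h4 := hbd _ ((inv_exitTime_lt_iff hx hw).1 h3)
    have h5 := hbd _ (slice_subset_cone hx)
    rw [map_add, map_smul, hw, hx.1, smul_eq_mul] at h4
    rw [hx.1] at h5
    rw [mem_closedBall_zero_iff]
    have h6 : ‖w‖ ≤ ‖(2 : ℝ) • x + w‖ + ‖(2 : ℝ) • x‖ := by
      have := norm_sub_le ((2 : ℝ) • x + w) ((2 : ℝ) • x)
      simpa using this
    rw [norm_smul] at h6
    norm_num at h4 h5 h6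
    linarith
  · rintro ⟨⟨hx, -, hw⟩, hF⟩
    exact ⟨⟨(x, w), hKs hx, hw, hF⟩, hx, rfl⟩

/-- The two points fix the direction up to a positive factor, and the unit norm fixes the factor.
This lets distances of footpoints at two times detect the topology of the unit tangent bundle. -/
theorem ext_of_pos {v u : Ω.UnitTangent} (h0 : v.pos 0 = u.pos 0) (h1 : v.pos 1 = u.pos 1) :
    v = u := by
  rw [pos_zero, pos_zero] at h0
  have pv1 := v.inv_fwd_pos
  have pv2 := v.inv_bwd_pos
  have pu1 := u.inv_fwd_pos
  have pu2 := u.inv_bwd_pos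
  have sv := v.inv_add_inv
  have su := u.inv_add_inv
  unfold pos geodesic at h1
  obtain ⟨⟨x, w⟩, hx, hw, hF⟩ := v
  obtain ⟨⟨x', w'⟩, hx', hw', hF'⟩ := u
  dsimp only at *
  subst h0
  have hE : 1 < Real.exp (2 * 1) := Real.one_lt_exp_iff.2 (by norm_num)
  have hE' := sub_pos.2 hE
  set E := Real.exp (2 * 1)
  rw [add_right_inj] at h1
  set s := (E - 1) / ((Ω.exitTime x (-w))⁻¹ + (Ω.exitTime x w)⁻¹ * E)
  set s' := (E - 1) / ((Ω.exitTime x (-w'))⁻¹ + (Ω.exitTime x w')⁻¹ * E)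
  have hs : 0 < s := by positivity
  have hs' : 0 < s' := by positivity
  have e : w' = (s / s') • w := by
    rw [div_eq_inv_mul, ← smul_smul, h1, smul_smul, inv_mul_cancel₀ hs'.ne', one_smul]
  have hc : 0 < s / s' := by positivity
  have e2 : -w' = (s / s') • -w := by rw [e, smul_neg]
  rw [e2, e, inv_exitTime_smul hx hw hc, inv_exitTime_smul hx (by simp [hw]) hc, ← mul_add, sv]
    at su
  have : s / s' = 1 := by linarith
  rw [this, one_smul] at e
  subst e
  rfl

/-- After time `s` the exit times are shifted by the parameter already travelled and rescaled by the
new velocity. Both sides then become the same fractional linear expression in the exponentials. -/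
theorem pos_flow (v : Ω.UnitTangent) (s t : ℝ) : (Ω.flow s v).pos t = v.pos (s + t) := by
  have hm := v.pos_mem s
  have pv1 := v.inv_fwd_pos
  have pv2 := v.inv_bwd_pos
  have sv := v.inv_add_inv
  have hd := (hasDerivAt_geodesic v s).deriv
  change Ω.geodesic (Ω.geodesic v.1.1 v.1.2 s) (deriv (Ω.geodesic v.1.1 v.1.2) s) t =
    Ω.geodesic v.1.1 v.1.2 (s + t)
  rw [hd]
  obtain ⟨⟨x, w⟩, hx, hw, hF⟩ := v
  unfold pos geodesic at *
  dsimp only at *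
  have hw0 := ne_zero_of_finslerNorm hF
  obtain ⟨h1, h2⟩ := exitTime_add_smul (x := x) (w := w) hx hw hw0 hm
  have hE := Real.exp_pos (2 * s)
  have hE2 := Real.exp_pos (2 * t)
  have hadd : Real.exp (2 * (s + t)) = Real.exp (2 * s) * Real.exp (2 * t) := by
    rw [mul_add, Real.exp_add]
  rw [hadd]
  obtain ⟨a, ha⟩ : ∃ a, a = (Ω.exitTime x (-w))⁻¹ := ⟨_, rfl⟩
  obtain ⟨b, hb⟩ : ∃ b, b = (Ω.exitTime x w)⁻¹ := ⟨_, rfl⟩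
  have ha' : Ω.exitTime x (-w) = a⁻¹ := by rw [ha, inv_inv]
  have hb' : Ω.exitTime x w = b⁻¹ := by rw [hb, inv_inv]
  have ha0 : 0 < a := ha ▸ pv2
  have hb0 : 0 < b := hb ▸ pv1
  rw [ha', hb'] at hm h1 h2 sv ⊢
  simp only [inv_inv] at hm h1 h2 sv ⊢
  set E := Real.exp (2 * s)
  set G := Real.exp (2 * t)
  have hD : 0 < a + b * E := by positivity
  have hc : 0 < 4 * E / (a + b * E) ^ 2 := by positivity
  have hba : b = 2 - a := by linarith
  rw [← smul_neg, inv_exitTime_smul (w := w) hm hw hc, inv_exitTime_smul hm (by rw [map_neg, neg_eq_zero]; exact hw) hc, h1, h2]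
  have e1 : b⁻¹ - (E - 1) / (a + b * E) = 2 / (b * (a + b * E)) := by
    field_simp; rw [hba]; ring
  have e2 : a⁻¹ + (E - 1) / (a + b * E) = 2 * E / (a * (a + b * E)) := by
    field_simp; rw [hba]; ring
  rw [e1, e2, add_assoc, smul_smul, ← add_smul]
  congr 2
  have hD2 : 0 < a + b * (E * G) := by positivity
  have e3 : 4 * E / (a + b * E) ^ 2 * (2 * E / (a * (a + b * E)))⁻¹ +
      4 * E / (a + b * E) ^ 2 * (2 / (b * (a + b * E)))⁻¹ * G =
      2 * (a + b * (E * G)) / (a + b * E) := by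
    field_simp
    norm_num
  rw [e3]
  field_simp
  rw [hba]
  ring

/-- Unit speed. Equality holds, but only the upper bound is used. The flow law reduces it to the
initial time 0, where the cross ratio is `exp (2 * r)`. -/
theorem coneDist_pos_le (v : Ω.UnitTangent) (s t : ℝ) :
    Ω.coneDist (v.pos s) (v.pos t) ≤ |t - s| := by
  wlog hst : s ≤ t generalizing s t
  · rw [coneDist_comm, abs_sub_comm]
    exact this t s (le_of_not_ge hst)
  have key : ∀ u : Ω.UnitTangent, ∀ r : ℝ, 0 ≤ r → Ω.coneDist (u.pos 0) (u.pos r) = r := by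
    intro u r hr
    have hm := u.pos_mem r
    have pv1 := u.inv_fwd_pos
    have pv2 := u.inv_bwd_pos
    have sv := u.inv_add_inv
    rw [pos_zero]
    obtain ⟨⟨x, w⟩, hx, hw, hF⟩ := u
    unfold pos geodesic at *
    dsimp only at *
    have hw0 := ne_zero_of_finslerNorm hF
    have hE : 1 ≤ Real.exp (2 * r) := Real.one_le_exp (by positivity)
    have hlog : Real.log (Real.exp (2 * r)) = 2 * r := Real.log_exp _
    set a := (Ω.exitTime x (-w))⁻¹ with ha
    set b := (Ω.exitTime x w)⁻¹ with hb
    set E := Real.exp (2 * r)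
    have hD : 0 < a + b * E := by positivity
    have h := coneDist_line hx hw hw0 (s := 0) (by simpa using hx) hm
      (div_nonneg (by linarith) hD.le)
    rw [zero_smul, add_zero] at h
    have hba : b = 2 - a := by linarith
    rw [h, linePos, linePos, ← ha, ← hb]
    have e1 : 1 + a * ((E - 1) / (a + b * E)) = 2 * E / (a + b * E) := by
      field_simp; rw [hba]; ring
    have e2 : 1 - b * ((E - 1) / (a + b * E)) = 2 / (a + b * E) := by
      field_simp; rw [hba]; ring
    rw [e1, e2, ← Real.log_div (by positivity) (by positivity)]
    have e3 : 2 * E / (a + b * E) / (2 / (a + b * E)) = E := by field_simp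
    rw [e3, hlog]
    simp
  have h1 := key (Ω.flow s v) (t - s) (sub_nonneg.2 hst)
  rw [pos_flow, pos_flow, add_zero, add_sub_cancel] at h1
  rw [h1, abs_of_nonneg (sub_nonneg.2 hst)]

end UnitTangent

/-! ### Two geodesics stay close when they are close at both ends -/

/-- If `l` is admissible at both ends, the vectors `l yᵢ - xᵢ` lie in the cone, and so does their
combination with the common weights. -/
theorem dil_segment_le {x₀ x₁ y₀ y₁ : Fin (n + 1) → ℝ} (hy₀ : y₀ ∈ Ω.cone) (hy₁ : y₁ ∈ Ω.cone)
    {α β : ℝ} (hα : 0 ≤ α) (hβ : 0 ≤ β) (hαβ : 0 < α + β) :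
    Ω.dil (α • x₀ + β • x₁) (α • y₀ + β • y₁) ≤ max (Ω.dil x₀ y₀) (Ω.dil x₁ y₁) := by
  have comb : ∀ {p q : Fin (n + 1) → ℝ}, p ∈ Ω.cone → q ∈ Ω.cone → α • p + β • q ∈ Ω.cone := by
    intro p q hp hq
    rcases hα.eq_or_lt with rfl | hα
    · rw [zero_add] at hαβ
      simpa using smul_mem_cone hαβ hq
    rcases hβ.eq_or_lt with rfl | hβ
    · simpa using smul_mem_cone hα hp
    exact add_mem_cone (smul_mem_cone hα hp) (smul_mem_cone hβ hq)
  refine le_of_forall_gt fun l hl => (dil_lt_iff (comb hy₀ hy₁)).2 ?_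
  obtain ⟨h0, h1⟩ := max_lt_iff.1 hl
  have := comb ((dil_lt_iff hy₀).1 h0) ((dil_lt_iff hy₁).1 h1)
  convert this using 1
  module

/-- If the product were below 1, there would be `l`, `m` with `m l < 1` and both `l (G P₂ + Q₂) - (G
P₁ + Q₁)` and `m (P₁ + Q₁) - (P₂ + Q₂)` in the cone. Adding `l` times the second to the first
removes `Q₂`, and adding `(1 - m l) (P₁ + Q₁)` removes `Q₁`. What remains is `l (G - 1) P₂ - (G - 1)
P₁`, and adding `(G - 1) P₁` from the closed cone forces `P₂` into the open cone. -/
theorem one_le_dil_mul_dil_of_boundary {P₁ Q₁ P₂ Q₂ : Fin (n + 1) → ℝ} {G : ℝ} (hG : 1 < G)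
    (hP₁ : P₁ ∈ closure Ω.cone) (hP₂ : P₂ ∉ Ω.cone) (h1 : P₁ + Q₁ ∈ Ω.cone)
    (hG2 : G • P₂ + Q₂ ∈ Ω.cone) (h2 : P₂ + Q₂ ∈ Ω.cone) :
    1 ≤ Ω.dil (G • P₁ + Q₁) (G • P₂ + Q₂) * Ω.dil (P₂ + Q₂) (P₁ + Q₁) := by
  by_contra! hlt
  have hp := dil_pos h2 h1
  have hl : Ω.dil (G • P₁ + Q₁) (G • P₂ + Q₂) < 1 / Ω.dil (P₂ + Q₂) (P₁ + Q₁) := by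
    rwa [lt_div_iff₀ hp]
  obtain ⟨l, hl1, hl2⟩ := exists_between hl
  rw [lt_div_iff₀ hp] at hl2
  have hG1 : G • P₁ + Q₁ ∈ Ω.cone := by
    have hcl : (G - 1) • P₁ ∈ closure Ω.cone := by
      refine map_mem_closure (continuous_const_smul (G - 1)) hP₁ fun z hz => ?_
      exact smul_mem_cone (sub_pos.2 hG) hz
    have := add_closure_mem_cone h1 hcl
    convert this using 1
    module
  have hl0 : 0 < l := (dil_pos hG1 hG2).trans hl1
  have : Ω.dil (P₂ + Q₂) (P₁ + Q₁) < 1 / l := by rwa [lt_div_iff₀ hl0, mul_comm]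
  obtain ⟨m, hm1, hm2⟩ := exists_between this
  rw [lt_div_iff₀ hl0] at hm2
  have i1 := (dil_lt_iff hG2).1 hl1
  have i2 := (dil_lt_iff h1).1 hm1
  have i3 := add_mem_cone i1 (smul_mem_cone hl0 i2)
  have hcl : (G - 1) • P₁ ∈ closure Ω.cone := by
    refine map_mem_closure (continuous_const_smul (G - 1)) hP₁ fun z hz => ?_
    exact smul_mem_cone (sub_pos.2 hG) hz
  have hml : 0 < 1 - m * l := by linarith
  have i4 := add_closure_mem_cone (add_mem_cone i3 (smul_mem_cone hml h1)) hcl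
  apply hP₂
  have hlG : 0 < l * (G - 1) := mul_pos hl0 (sub_pos.2 hG)
  rw [← smul_mem_cone_iff hlG]
  convert i4 using 1
  module

theorem coneDist_affine_le {P₁ Q₁ P₂ Q₂ : Fin (n + 1) → ℝ} {E G : ℝ} (hE : 1 ≤ E) (hEG : E ≤ G)
    (hG : 1 < G) (hP₁ : P₁ ∈ closure Ω.cone) (hP₂ : P₂ ∈ closure Ω.cone)
    (hP₁' : P₁ ∉ Ω.cone) (hP₂' : P₂ ∉ Ω.cone) (h1 : ∀ s : ℝ, 0 < s → s • P₁ + Q₁ ∈ Ω.cone)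
    (h2 : ∀ s : ℝ, 0 < s → s • P₂ + Q₂ ∈ Ω.cone) :
    Ω.coneDist (E • P₁ + Q₁) (E • P₂ + Q₂) ≤
      Ω.coneDist (P₁ + Q₁) (P₂ + Q₂) + Ω.coneDist (G • P₁ + Q₁) (G • P₂ + Q₂) := by
  have h10 : P₁ + Q₁ ∈ Ω.cone := by simpa using h1 1 one_pos
  have h20 : P₂ + Q₂ ∈ Ω.cone := by simpa using h2 1 one_pos
  have h1E := h1 E (by linarith)
  have h2E := h2 E (by linarith)
  have h1G := h1 G (by linarith)
  have h2G := h2 G (by linarith)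
  -- The barycentric weights of `E` with respect to 1 and `G`. They are the same for both lines, as
  -- `dil_segment_le` requires.
  have hα : 0 ≤ (G - E) / (G - 1) := div_nonneg (by linarith) (by linarith)
  have hβ : 0 ≤ (E - 1) / (G - 1) := div_nonneg (by linarith) (by linarith)
  have hG1 : G - 1 ≠ 0 := by linarith
  have hαβ : (G - E) / (G - 1) + (E - 1) / (G - 1) = 1 := by field_simp; ring
  have hE' : (G - E) / (G - 1) + (E - 1) / (G - 1) * G = E := by field_simp; ring
  have comb : ∀ P Q : Fin (n + 1) → ℝ, E • P + Q =
      ((G - E) / (G - 1)) • (P + Q) + ((E - 1) / (G - 1)) • (G • P + Q) := by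
    intro P Q
    have : ((G - E) / (G - 1)) • (P + Q) + ((E - 1) / (G - 1)) • (G • P + Q) =
      ((G - E) / (G - 1) + (E - 1) / (G - 1) * G) • P +
        ((G - E) / (G - 1) + (E - 1) / (G - 1)) • Q := by module
    rw [this, hαβ, hE', one_smul]
  have d1 := dil_segment_le (x₀ := P₁ + Q₁) (x₁ := G • P₁ + Q₁) h20 h2G hα hβ (by linarith)
  have d2 := dil_segment_le (x₀ := P₂ + Q₂) (x₁ := G • P₂ + Q₂) h10 h1G hα hβ (by linarith)
  rw [← comb, ← comb] at d1 d2
  have b1 := one_le_dil_mul_dil_of_boundary hG hP₁ hP₂' h10 h2G h20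
  have b2 := one_le_dil_mul_dil_of_boundary hG hP₂ hP₁' h20 h1G h10
  have p1 := dil_pos h1E h2E
  have p2 := dil_pos h2E h1E
  have q1 := dil_pos h10 h20
  have q2 := dil_pos h20 h10
  have r1 := dil_pos h1G h2G
  have r2 := dil_pos h2G h1G
  have hA := one_le_dil_mul_dil h10 h20
  have hB := one_le_dil_mul_dil h1G h2G
  rw [coneDist, coneDist, coneDist, ← mul_add, ← Real.log_mul (by positivity) (by positivity)]
  generalize Ω.dil (E • P₁ + Q₁) (E • P₂ + Q₂) = le at *
  generalize Ω.dil (E • P₂ + Q₂) (E • P₁ + Q₁) = me at *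
  generalize Ω.dil (P₁ + Q₁) (P₂ + Q₂) = l0 at *
  generalize Ω.dil (P₂ + Q₂) (P₁ + Q₁) = m0 at *
  generalize Ω.dil (G • P₁ + Q₁) (G • P₂ + Q₂) = lt at *
  generalize Ω.dil (G • P₂ + Q₂) (G • P₁ + Q₁) = mt at *
  -- If both maxima are attained at the same end, the product at the other end is at least 1. If
  -- they are attained at opposite ends, the missing factors are `lt * m0` or `mt * l0`, bounded
  -- below by `b1` and `b2`.
  have key : le * me ≤ l0 * m0 * (lt * mt) := by
    refine (mul_le_mul d1 d2 p2.le (by positivity)).trans ?_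
    rcases max_cases l0 lt with ⟨e1, -⟩ | ⟨e1, -⟩ <;>
      rcases max_cases m0 mt with ⟨e2, -⟩ | ⟨e2, -⟩ <;> rw [e1, e2]
    · exact le_mul_of_one_le_right (by positivity) hB
    · calc l0 * mt ≤ l0 * mt * (lt * m0) := le_mul_of_one_le_right (by positivity) b1
        _ = _ := by ring
    · calc lt * m0 ≤ lt * m0 * (mt * l0) := le_mul_of_one_le_right (by positivity) b2
        _ = _ := by ring
    · exact le_mul_of_one_le_left (by positivity) hA
  gcongr

/-! ### Geodesics as affine lines in the cone -/

namespace UnitTangent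

/-- Up to scale, the forward endpoint of the geodesic of `v`. -/
def fwd (v : Ω.UnitTangent) : Fin (n + 1) → ℝ := (Ω.exitTime v.1.1 v.1.2)⁻¹ • v.1.1 + v.1.2

/-- Up to scale, the backward endpoint of the geodesic of `v`. -/
def bwd (v : Ω.UnitTangent) : Fin (n + 1) → ℝ := (Ω.exitTime v.1.1 (-v.1.2))⁻¹ • v.1.1 - v.1.2

theorem fwd_not_mem (v : Ω.UnitTangent) : v.fwd ∉ Ω.cone := fun h =>
  lt_irrefl _ ((inv_exitTime_lt_iff v.2.1 v.2.2.1).2 h)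

theorem fwd_mem_closure (v : Ω.UnitTangent) : v.fwd ∈ closure Ω.cone := by
  have h : ContinuousWithinAt (fun c : ℝ => c • v.1.1 + v.1.2) (Ioi (Ω.exitTime v.1.1 v.1.2)⁻¹)
      (Ω.exitTime v.1.1 v.1.2)⁻¹ := by fun_prop
  refine h.mem_closure (by simp [closure_Ioi]) fun c hc => ?_
  exact (inv_exitTime_lt_iff v.2.1 v.2.2.1).1 hc

/-- A lift of the geodesic to the cone that is affine in `exp (2 * t)`. The positive scalar does not
affect `coneDist`. -/
theorem affine_eq (v : Ω.UnitTangent) (t : ℝ) : Real.exp (2 * t) • v.fwd + v.bwd =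
    ((Ω.exitTime v.1.1 (-v.1.2))⁻¹ + (Ω.exitTime v.1.1 v.1.2)⁻¹ * Real.exp (2 * t)) • v.pos t := by
  have h1 := v.inv_fwd_pos
  have h2 := v.inv_bwd_pos
  have h3 := Real.exp_pos (2 * t)
  have hD : 0 < (Ω.exitTime v.1.1 (-v.1.2))⁻¹ + (Ω.exitTime v.1.1 v.1.2)⁻¹ * Real.exp (2 * t) := by
    positivity
  rw [pos, geodesic, smul_add, smul_smul, mul_div_cancel₀ _ hD.ne', fwd, bwd]
  module

theorem affine_mem (v : Ω.UnitTangent) {s : ℝ} (hs : 0 < s) : s • v.fwd + v.bwd ∈ Ω.cone := by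
  have h1 := v.inv_fwd_pos
  have h2 := v.inv_bwd_pos
  have h := v.affine_eq (Real.log s / 2)
  rw [mul_div_cancel₀ _ two_ne_zero, Real.exp_log hs] at h
  rw [h]
  exact smul_mem_cone (by positivity) (v.pos_mem_cone _)

theorem coneDist_affine_eq (v u : Ω.UnitTangent) (t : ℝ) :
    Ω.coneDist (Real.exp (2 * t) • v.fwd + v.bwd) (Real.exp (2 * t) • u.fwd + u.bwd) =
      Ω.coneDist (v.pos t) (u.pos t) := by
  have h1 := v.inv_fwd_pos
  have h2 := v.inv_bwd_pos
  have h3 := u.inv_fwd_pos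
  have h4 := u.inv_bwd_pos
  have h5 := Real.exp_pos (2 * t)
  rw [affine_eq, affine_eq, coneDist_smul (v.pos_mem_cone t) (u.pos_mem_cone t) (by positivity)
    (by positivity)]

/-- The Hilbert distance of two unit speed lines at a time is at most the sum of the distances at
an earlier and a later time. -/
theorem coneDist_pos_le_add (v u : Ω.UnitTangent) {t T : ℝ} (ht : 0 ≤ t) (htT : t ≤ T) :
    Ω.coneDist (v.pos t) (u.pos t) ≤
      Ω.coneDist (v.pos 0) (u.pos 0) + Ω.coneDist (v.pos T) (u.pos T) := by
  rcases (ht.trans htT).eq_or_lt with h | hT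
  · have : t = 0 := by linarith
    rw [this]
    have := coneDist_nonneg (v.pos_mem_cone T) (u.pos_mem_cone T)
    linarith
  rw [← coneDist_affine_eq v u t, ← coneDist_affine_eq v u 0, ← coneDist_affine_eq v u T]
  simp only [mul_zero, Real.exp_zero, one_smul]
  exact coneDist_affine_le (Real.one_le_exp (by linarith)) (Real.exp_le_exp.2 (by linarith))
    (Real.one_lt_exp_iff.2 (by linarith)) v.fwd_mem_closure u.fwd_mem_closure v.fwd_not_mem
    u.fwd_not_mem (fun s hs => v.affine_mem hs) (fun s hs => u.affine_mem hs)

end UnitTangent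

/-! ### Automorphisms are isometries -/

/-- A matrix of an automorphism maps the cone to itself or to its negative. Dividing by the chart
value at one image point fixes the sign, since by `chartMap_line` this value keeps its sign along
the segment to the normalized `z`. -/
theorem inv_chart_smul_mulVec_mem_cone (g : Ω.aut) {x z : Fin (n + 1) → ℝ} (hx : x ∈ Ω.slice)
    (hz : z ∈ Ω.cone) : (Ω.chart (repMatrix g.1 *ᵥ x))⁻¹ • (repMatrix g.1 *ᵥ z) ∈ Ω.cone := by
  have hl := chart_rep_ne_zero g hx
  refine ⟨?_, mk_smul_mem (inv_ne_zero hl) (repMatrix_mem g hz.2)⟩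
  have hz' := inv_chart_smul_mem_slice hz
  have h := (chartMap_line g hx (w := (Ω.chart z)⁻¹ • z - x) 1 (by simpa using hz')).1
  rw [mul_one, Matrix.mulVec_sub, Matrix.mulVec_smul, map_sub, map_smul, sub_div, div_self hl,
    smul_eq_mul, add_sub_cancel] at h
  have := mul_pos (chart_pos hz) h
  rw [map_smul, smul_eq_mul]
  have e : Ω.chart z * ((Ω.chart z)⁻¹ * Ω.chart (repMatrix g.1 *ᵥ z) / Ω.chart (repMatrix g.1 *ᵥ x))
      = (Ω.chart (repMatrix g.1 *ᵥ x))⁻¹ * Ω.chart (repMatrix g.1 *ᵥ z) := by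
    have := (chart_pos hz).ne'
    field_simp
  rwa [e] at this

theorem dil_map_le (B : Matrix (Fin (n + 1)) (Fin (n + 1)) ℝ)
    (hB : ∀ z ∈ Ω.cone, B *ᵥ z ∈ Ω.cone) {x y : Fin (n + 1) → ℝ} (hy : y ∈ Ω.cone) :
    Ω.dil (B *ᵥ x) (B *ᵥ y) ≤ Ω.dil x y := by
  refine le_of_forall_gt fun l hl => (dil_lt_iff (hB _ hy)).2 ?_
  have := hB _ ((dil_lt_iff hy).1 hl)
  rwa [Matrix.mulVec_sub, Matrix.mulVec_smul] at this

theorem coneDist_map_le (B : Matrix (Fin (n + 1)) (Fin (n + 1)) ℝ)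
    (hB : ∀ z ∈ Ω.cone, B *ᵥ z ∈ Ω.cone) {x y : Fin (n + 1) → ℝ} (hx : x ∈ Ω.cone)
    (hy : y ∈ Ω.cone) : Ω.coneDist (B *ᵥ x) (B *ᵥ y) ≤ Ω.coneDist x y := by
  have h1 := dil_map_le B hB hy (x := x)
  have h2 := dil_map_le B hB hx (x := y)
  have h3 := dil_pos (hB _ hx) (hB _ hy)
  have h4 := dil_pos (hB _ hy) (hB _ hx)
  have h5 := dil_pos hx hy
  unfold coneDist
  gcongr

namespace Point

theorem mem_cone (p : Ω.Point) : p.1 ∈ Ω.cone := slice_subset_cone p.2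

theorem coneDist_smul_le (g : Ω.aut) (p q : Ω.Point) :
    Ω.coneDist (g • p).1 (g • q).1 ≤ Ω.coneDist p.1 q.1 := by
  have hB : ∀ z ∈ Ω.cone,
      ((Ω.chart (repMatrix g.1 *ᵥ p.1))⁻¹ • repMatrix g.1) *ᵥ z ∈ Ω.cone := by
    intro z hz
    rw [Matrix.smul_mulVec]
    exact inv_chart_smul_mulVec_mem_cone g p.2 hz
  have e : ∀ r : Ω.Point, (g • r).1 = (Ω.chart (((Ω.chart (repMatrix g.1 *ᵥ p.1))⁻¹ •
      repMatrix g.1) *ᵥ r.1))⁻¹ • (((Ω.chart (repMatrix g.1 *ᵥ p.1))⁻¹ • repMatrix g.1) *ᵥ r.1) := by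
    intro r
    have := chartMap_smul (Ω := Ω) (inv_ne_zero (chart_rep_ne_zero g p.2)) (repMatrix g.1)
    exact (congrFun this r.1).symm
  rw [e p, e q, coneDist_smul (hB _ p.mem_cone) (hB _ q.mem_cone)
    (inv_pos.2 (chart_pos (hB _ p.mem_cone))) (inv_pos.2 (chart_pos (hB _ q.mem_cone)))]
  exact coneDist_map_le _ hB p.mem_cone q.mem_cone

theorem coneDist_smul_smul (g : Ω.aut) (p q : Ω.Point) :
    Ω.coneDist (g • p).1 (g • q).1 = Ω.coneDist p.1 q.1 := by
  refine le_antisymm (coneDist_smul_le g p q) ?_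
  have := coneDist_smul_le g⁻¹ (g • p) (g • q)
  rwa [inv_smul_smul, inv_smul_smul] at this

end Point

instance (Ω : ProperlyConvexDomain n) : ContinuousConstSMul Ω.aut Ω.Point where
  continuous_const_smul g := by
    refine Continuous.subtype_mk (continuous_iff_continuousAt.2 fun p => ?_) _
    have := (hasFDerivAt_chartMap (Ω := Ω) _ (chart_rep_ne_zero g p.2)).1.continuousAt
    exact this.comp continuous_subtype_val.continuousAt

/-! ### Discrete groups of automorphisms -/

/-- A ball of uniform radius `r` about each `y` in `N` lies in the cone. For `‖u‖ ≤ r` both `B (y +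
u)` and `B (y - u)` are in the cone, with chart values adding up to 2, so `‖B u‖ ≤ R`. -/
theorem exists_norm_mulVec_le {N : Set (Fin (n + 1) → ℝ)} (hN : IsCompact N)
    (hNs : N ⊆ Ω.slice) : ∃ C : ℝ, 0 < C ∧ ∀ B : Matrix (Fin (n + 1)) (Fin (n + 1)) ℝ,
      (∀ z ∈ Ω.cone, B *ᵥ z ∈ Ω.cone) → ∀ y ∈ N, Ω.chart (B *ᵥ y) = 1 →
        ∀ z, ‖B *ᵥ z‖ ≤ C * ‖z‖ := by
  obtain ⟨R, hR, hbd⟩ := exists_norm_le_chart Ω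
  obtain ⟨r, hr, hrs⟩ := hN.exists_cthickening_subset_open isOpen_coneSet
    (hNs.trans slice_subset_cone)
  refine ⟨R / r, by positivity, fun B hB y hy hBy z => ?_⟩
  rcases eq_or_ne z 0 with rfl | hz
  · simp
  have hz' : 0 < ‖z‖ := norm_pos_iff.2 hz
  have hmem : ∀ u : Fin (n + 1) → ℝ, ‖u‖ ≤ r → y + u ∈ Ω.cone := fun u hu =>
    hrs (Metric.mem_cthickening_of_dist_le _ y _ _ hy (by simpa using hu))
  set u := (r / ‖z‖) • z with hu
  have hur : ‖u‖ ≤ r := by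
    rw [hu, norm_smul, Real.norm_of_nonneg (by positivity), div_mul_cancel₀ _ hz'.ne']
  have h1 := hbd _ (hB _ (hmem u hur))
  have h2 := hbd _ (hB _ (hmem (-u) (by rwa [norm_neg])))
  rw [Matrix.mulVec_add] at h1 h2
  rw [map_add, hBy] at h1 h2
  rw [Matrix.mulVec_neg, map_neg] at h2
  have h3 : ‖(2 : ℝ) • (B *ᵥ u)‖ ≤ ‖B *ᵥ y + B *ᵥ u‖ + ‖B *ᵥ y + -(B *ᵥ u)‖ := by
    have := norm_sub_le (B *ᵥ y + B *ᵥ u) (B *ᵥ y + -(B *ᵥ u))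
    have e : (2 : ℝ) • (B *ᵥ u) = B *ᵥ y + B *ᵥ u - (B *ᵥ y + -(B *ᵥ u)) := by module
    rwa [e]
  rw [norm_smul, Real.norm_of_nonneg zero_le_two] at h3
  have h4 : ‖B *ᵥ u‖ ≤ R := by linarith
  rw [hu, Matrix.mulVec_smul, norm_smul, Real.norm_of_nonneg (by positivity)] at h4
  calc ‖B *ᵥ z‖ = (‖z‖ / r) * (r / ‖z‖ * ‖B *ᵥ z‖) := by field_simp
    _ ≤ (‖z‖ / r) * R := by gcongr
    _ = _ := by ring

theorem isCompact_abs_entries_le (C : ℝ) :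
    IsCompact {B : Matrix (Fin (n + 1)) (Fin (n + 1)) ℝ | ∀ i j, |B i j| ≤ C} := by
  change IsCompact (X := Fin (n + 1) → Fin (n + 1) → ℝ) {B | ∀ i j, |B i j| ≤ C}
  have := isCompact_univ_pi fun _ : Fin (n + 1) =>
    isCompact_univ_pi fun _ : Fin (n + 1) => isCompact_Icc (a := -C) (b := C)
  convert this using 1
  ext B
  simp only [Set.mem_ofPred_eq, Set.mem_pi, Set.mem_univ, true_imp_iff, mem_Icc, abs_le]

theorem exists_abs_det_le (C : ℝ) : ∃ D : ℝ, 0 < D ∧ ∀ B : Matrix (Fin (n + 1)) (Fin (n + 1)) ℝ,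
    (∀ z, ‖B *ᵥ z‖ ≤ C * ‖z‖) → |B.det| ≤ D := by
  have hdet : Continuous fun B : Matrix (Fin (n + 1)) (Fin (n + 1)) ℝ => |B.det| :=
    (continuous_id.matrix_det).abs
  obtain ⟨D, hD⟩ := ((isCompact_abs_entries_le C).image hdet).bddAbove
  refine ⟨max D 1, by positivity, fun B hB => le_max_of_le_left (hD ⟨B, fun i j => ?_, rfl⟩)⟩
  have h1 := hB (Pi.single j 1)
  have h2 := norm_le_pi_norm (B *ᵥ Pi.single j 1) i
  simp only [Matrix.mulVec_single, MulOpposite.op_one, one_smul, Pi.norm_single, norm_one,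
    mul_one] at h1 h2
  exact h2.trans h1

/-- Properness of the action. The matrix divided by its chart value `l` at `x` is bounded by
`exists_norm_mulVec_le`. The normalized inverse matrix is bounded too, because the image of `x`
stays in a compact set. Its determinant has absolute value `|l| ^ (n + 1)`, which bounds `l`. -/
theorem abs_repMatrix_le_of_mem {x : Fin (n + 1) → ℝ} (hx : x ∈ Ω.slice) (r : ℝ) :
    ∃ C : ℝ, ∀ g : Ω.aut, Ω.coneDist x (Ω.chartMap (repMatrix g.1) x) ≤ r →
      ∀ i j, |repMatrix g.1 i j| ≤ C := by
  obtain ⟨N, hN, hNs, hNr⟩ := exists_isCompact_nhds (isCompact_singleton (x := x))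
    (singleton_subset_iff.2 hx) r
  obtain ⟨C₁, hC₁, h₁⟩ := exists_norm_mulVec_le (isCompact_singleton (x := x))
    (singleton_subset_iff.2 hx)
  obtain ⟨C₂, hC₂, h₂⟩ := exists_norm_mulVec_le hN hNs
  obtain ⟨D, hD, hdet⟩ := exists_abs_det_le (n := n) C₂
  refine ⟨max 1 D * C₁, fun g hg i j => ?_⟩
  have hy := chartMap_mem g hx
  have hyN := hNr x rfl _ hy hg
  have hl := chart_rep_ne_zero g hx
  have hl' := chart_rep_ne_zero g⁻¹ hy
  have hdetg : ∀ g : PSL(n + 1, ℝ), (repMatrix g).det = 1 := fun g => (Quotient.out g).2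
  obtain ⟨c, hc, e⟩ := repMatrix_mul (g⁻¹).1 g.1
  obtain ⟨c', hc', e'⟩ := repMatrix_one (n := n)
  have e3 : repMatrix (g⁻¹).1 * repMatrix g.1 = (c⁻¹ * c') • 1 := by
    rw [← Subgroup.coe_mul, inv_mul_cancel, Subgroup.coe_one, e'] at e
    rw [mul_smul, e, smul_smul, inv_mul_cancel₀ hc, one_smul]
  set k := c⁻¹ * c'
  have hk : |k| = 1 := by
    have := congrArg Matrix.det e3
    rw [Matrix.det_mul, hdetg, hdetg, Matrix.det_smul, Matrix.det_one, mul_one, mul_one,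
      Fintype.card_fin] at this
    have h := congrArg abs this
    rw [abs_one, abs_pow] at h
    exact (pow_eq_one_iff_of_nonneg (abs_nonneg k) (Nat.succ_ne_zero n)).1 h.symm
  set l := Ω.chart (repMatrix g.1 *ᵥ x) with hldef
  have hl2 : Ω.chart (repMatrix (g⁻¹).1 *ᵥ Ω.chartMap (repMatrix g.1) x) = l⁻¹ * k := by
    rw [chartMap, Matrix.mulVec_smul, Matrix.mulVec_mulVec, e3, Matrix.smul_mulVec,
      Matrix.one_mulVec, map_smul, map_smul, hx.1, ← hldef]
    simp
  have b1 := h₁ (l⁻¹ • repMatrix g.1) (fun z hz => by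
    rw [Matrix.smul_mulVec]; exact inv_chart_smul_mulVec_mem_cone g hx hz) x rfl (by
    rw [Matrix.smul_mulVec, map_smul, ← hldef, smul_eq_mul, inv_mul_cancel₀ hl])
  have b2 := h₂ ((l⁻¹ * k)⁻¹ • repMatrix (g⁻¹).1) (fun z hz => by
    rw [Matrix.smul_mulVec, ← hl2]; exact inv_chart_smul_mulVec_mem_cone g⁻¹ hy hz) _ hyN (by
    rw [Matrix.smul_mulVec, map_smul, hl2, smul_eq_mul, inv_mul_cancel₀ (hl2 ▸ hl')])
  have hd := hdet _ b2
  rw [Matrix.det_smul, hdetg, mul_one, Fintype.card_fin, abs_pow, abs_inv, abs_mul, hk, mul_one,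
    abs_inv, inv_inv] at hd
  have hlD : |l| ≤ max 1 D := by
    rcases le_total |l| 1 with h | h
    · exact le_max_of_le_left h
    · exact le_max_of_le_right ((le_self_pow₀ h (Nat.succ_ne_zero n)).trans hd)
  have h3 := b1 (Pi.single j 1)
  have h4 := norm_le_pi_norm ((l⁻¹ • repMatrix g.1) *ᵥ Pi.single j 1) i
  have h5 : |l⁻¹ * repMatrix g.1 i j| ≤ C₁ := by
    simp only [Matrix.mulVec_single, MulOpposite.op_one, one_smul, Pi.norm_single, norm_one,
      mul_one] at h3 h4
    exact h4.trans h3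
  calc |repMatrix g.1 i j| = |l| * |l⁻¹ * repMatrix g.1 i j| := by
        rw [← abs_mul, mul_inv_cancel_left₀ hl]
    _ ≤ _ := by gcongr

/-- Matrices of determinant 1 with bounded entries form a compact set. Each has a neighbourhood `t`
whose quotients `a⁻¹ b` project into a neighbourhood of the identity that meets Γ only in 1, so `t`
contains at most one chosen representative. -/
theorem finite_of_abs_repMatrix_le (Γ : Subgroup Ω.aut) [DiscreteTopology Γ] (C : ℝ) :
    {γ : Γ | ∀ i j, |repMatrix γ.1.1 i j| ≤ C}.Finite := by
  let rep : Γ → Matrix.SpecialLinearGroup (Fin (n + 1)) ℝ := fun γ => Quotient.out γ.1.1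
  have hrep : ∀ γ, (rep γ : PSL(n + 1, ℝ)) = γ.1.1 := fun γ => repMatrix_spec γ.1.1
  set S : Set (Matrix.SpecialLinearGroup (Fin (n + 1)) ℝ) := {A | ∀ i j, |A.1 i j| ≤ C}
  have hS : IsCompact S := by
    have hcl : IsClosed {B : Matrix (Fin (n + 1)) (Fin (n + 1)) ℝ | B.det = 1} :=
      isClosed_eq continuous_id.matrix_det continuous_const
    have h2 := (isCompact_abs_entries_le C).inter_right hcl
    refine (Topology.IsEmbedding.subtypeVal.isCompact_iff).2 ?_
    convert h2 using 1
    ext B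
    constructor
    · rintro ⟨A, hA, rfl⟩
      exact ⟨fun i j => hA i j, A.2⟩
    · rintro ⟨h, hB⟩
      exact ⟨⟨B, hB⟩, h, rfl⟩
  have hnhds : ∃ U ∈ 𝓝 (1 : PSL(n + 1, ℝ)), ∀ γ : Γ, γ.1.1 ∈ U → γ = 1 := by
    have h1 : ({1} : Set Γ) ∈ 𝓝 (1 : Γ) := by rw [nhds_discrete]; exact mem_pure.2 rfl
    rw [nhds_induced, nhds_induced, Filter.comap_comap] at h1
    obtain ⟨U, hU, hU2⟩ := h1
    exact ⟨U, hU, fun γ hγ => hU2 hγ⟩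
  obtain ⟨U, hU, hU1⟩ := hnhds
  have key : (rep ⁻¹' S).Finite := by
    refine hS.induction_on (p := fun s => (rep ⁻¹' s).Finite) (by simp)
      (fun s t hst ht => ht.subset (preimage_mono hst))
      (fun s t hs ht => by rw [preimage_union]; exact hs.union ht) fun A _ => ?_
    have hc : ContinuousAt (fun p : Matrix.SpecialLinearGroup (Fin (n + 1)) ℝ ×
        Matrix.SpecialLinearGroup (Fin (n + 1)) ℝ => ((p.1⁻¹ * p.2 : _) : PSL(n + 1, ℝ)))
        (A, A) := by
      refine Continuous.continuousAt ?_
      exact QuotientGroup.continuous_mk.comp (continuous_fst.inv.mul continuous_snd)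
    have h2 : ∀ᶠ p in 𝓝 (A, A), ((p.1⁻¹ * p.2 :
        Matrix.SpecialLinearGroup (Fin (n + 1)) ℝ) : PSL(n + 1, ℝ)) ∈ U := by
      refine hc.eventually ?_
      simpa using hU
    rw [nhds_prod_eq, eventually_prod_self_iff'] at h2
    obtain ⟨t, ht, ht2⟩ := h2
    refine ⟨t, mem_nhdsWithin_of_mem_nhds ht, Set.Subsingleton.finite fun γ hγ γ' hγ' => ?_⟩
    have := ht2 _ hγ _ hγ'
    have h3 := hU1 (γ⁻¹ * γ') (by
      simp only at this
      rw [QuotientGroup.mk_mul, QuotientGroup.mk_inv, hrep, hrep] at this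
      exact this)
    exact (inv_mul_eq_one.1 h3)
  exact key

theorem finite_coneDist_smul_le (Γ : Subgroup Ω.aut) [DiscreteTopology Γ] (p : Ω.Point) (r : ℝ) :
    {γ : Γ | Ω.coneDist p.1 (γ • p).1 ≤ r}.Finite := by
  obtain ⟨C, hC⟩ := abs_repMatrix_le_of_mem p.2 r
  exact (finite_of_abs_repMatrix_le Γ C).subset fun γ hγ => hC γ.1 hγ

/-- Otherwise the infinitely many powers of γ would all have displacement 0 at `p`. -/
theorem eq_one_of_smul_eq {Γ : Subgroup Ω.aut} [DiscreteTopology Γ]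
    (htf : ∀ γ : Γ, γ ≠ 1 → ¬ IsOfFinOrder γ) {γ : Γ} {p : Ω.Point} (h : γ • p = p) : γ = 1 := by
  by_contra hne
  have hinj : Function.Injective fun k : ℕ => γ ^ k :=
    injective_pow_iff_not_isOfFinOrder.2 (htf γ hne)
  have hfin := finite_coneDist_smul_le Γ p 0
  refine Set.infinite_range_of_injective hinj (hfin.subset ?_)
  rintro _ ⟨k, rfl⟩
  have : γ ^ k • p = p := by
    have hm : γ ∈ MulAction.stabilizer Γ p := h
    exact pow_mem hm k
  simp only [Set.mem_ofPred_eq, this]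
  exact (coneDist_self p.mem_cone).le

theorem exists_le_coneDist_smul {Γ : Subgroup Ω.aut} [DiscreteTopology Γ]
    (htf : ∀ γ : Γ, γ ≠ 1 → ¬ IsOfFinOrder γ) (p : Ω.Point) :
    ∃ r > 0, ∀ γ : Γ, γ ≠ 1 → r ≤ Ω.coneDist p.1 (γ • p).1 := by
  have hfin := (finite_coneDist_smul_le Γ p 1).subset
    (sep_subset _ fun γ => γ ≠ 1)
  have hpos : ∀ γ : Γ, γ ≠ 1 → 0 < Ω.coneDist p.1 (γ • p).1 := fun γ hγ =>
    (coneDist_nonneg p.mem_cone (γ • p).mem_cone).lt_of_ne' fun h0 =>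
      hγ (eq_one_of_smul_eq htf (Subtype.ext (eq_of_coneDist_eq_zero p.2 (γ • p).2 h0)).symm)
  rcases Set.eq_empty_or_nonempty {γ ∈ {γ : Γ | Ω.coneDist p.1 (γ • p).1 ≤ 1} | γ ≠ 1} with
    h | h
  · refine ⟨1, one_pos, fun γ hγ => not_lt.1 fun hlt => ?_⟩
    have : γ ∈ (∅ : Set Γ) := by
      rw [← h]
      exact ⟨hlt.le, hγ⟩
    exact this
  · obtain ⟨γ₀, hγ₀, hmin⟩ := Set.exists_min_image _ (fun γ : Γ => Ω.coneDist p.1 (γ • p).1) hfin h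
    refine ⟨_, hpos γ₀ hγ₀.2, fun γ hγ => ?_⟩
    rcases le_total (Ω.coneDist p.1 (γ • p).1) 1 with h1 | h1
    · exact hmin γ ⟨h1, hγ⟩
    · exact hγ₀.1.trans h1

/-- A uniform version near a point. -/
theorem le_coneDist_smul_of_near {Γ : Subgroup Ω.aut} {p q : Ω.Point} {r : ℝ} {γ : Γ}
    (h : r ≤ Ω.coneDist p.1 (γ • p).1) (hq : Ω.coneDist p.1 q.1 < r / 4) :
    r / 2 ≤ Ω.coneDist q.1 (γ • q).1 := by
  have h1 := coneDist_triangle p.mem_cone q.mem_cone (γ • p).mem_cone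
  have h2 := coneDist_triangle q.mem_cone (γ • q).mem_cone (γ • p).mem_cone
  have h3 : Ω.coneDist (γ • q).1 (γ • p).1 = Ω.coneDist q.1 p.1 := Point.coneDist_smul_smul γ.1 q p
  rw [coneDist_comm q.1 p.1] at h3
  linarith

theorem eventually_coneDist_point_lt (p : Ω.Point) {e : ℝ} (he : 0 < e) :
    ∀ᶠ q : Ω.Point in 𝓝 p, Ω.coneDist p.1 q.1 < e :=
  (continuous_subtype_val.continuousAt.eventually (eventually_coneDist_lt p.mem_cone he)).mono
    fun _ h => h.2

instance (Γ : Subgroup Ω.aut) : ContinuousConstSMul Γ Ω.Point where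
  continuous_const_smul γ := continuous_const_smul γ.1

/-- If all displacements at `p` are at least `r`, they are at least `r / 2` on the ball of radius `r
/ 4`, so this ball is disjoint from its nontrivial translates. -/
theorem isQuotientCoveringMap {Γ : Subgroup Ω.aut} [DiscreteTopology Γ]
    (htf : ∀ γ : Γ, γ ≠ 1 → ¬ IsOfFinOrder γ) :
    IsQuotientCoveringMap (Quotient.mk _ : Ω.Point → Ω.QuotientSpace Γ) Γ where
  toIsQuotientMap := isQuotientMap_quotient_mk'
  continuous_const_smul := continuous_const_smul
  apply_eq_iff_mem_orbit := Quotient.eq''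
  disjoint p := by
    obtain ⟨r, hr, h⟩ := exists_le_coneDist_smul htf p
    refine ⟨_, eventually_coneDist_point_lt p (show 0 < r / 4 by positivity), fun γ hγ => ?_⟩
    by_contra hne
    obtain ⟨_, ⟨q, hq, rfl⟩, hq2⟩ := hγ
    have h1 := le_coneDist_smul_of_near (h γ hne) hq
    have h2 := coneDist_triangle q.mem_cone p.mem_cone (γ • q).mem_cone
    rw [coneDist_comm q.1 p.1] at h2
    simp only [Set.mem_ofPred_eq] at hq hq2
    linarith

/-! ### The quotient -/

/-- The images of the Hilbert balls about one point are an increasing open cover of the compact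
quotient, so one ball meets every orbit, and it lies in a compact subset of Ω. -/
theorem exists_isCompact_surj (Γ : Subgroup Ω.aut) [CompactSpace (Ω.QuotientSpace Γ)] :
    ∃ K : Set (Fin (n + 1) → ℝ), IsCompact K ∧ K ⊆ Ω.slice ∧
      ∀ p : Ω.Point, ∃ γ : Γ, (γ • p).1 ∈ K := by
  obtain ⟨z, hz⟩ := Ω.nonempty
  induction z using Projectivization.ind with | _ z hz0 => ?_
  have hzc := Ω.chart_ne_zero z hz0 hz
  let p₀ : Ω.Point := ⟨(Ω.chart z)⁻¹ • z, by simp [hzc], mk_smul_mem (inv_ne_zero hzc) ⟨hz0, hz⟩⟩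
  have hop : IsOpenMap (Quotient.mk _ : Ω.Point → Ω.QuotientSpace Γ) := isOpenMap_quotient_mk'_mul
  let V : ℕ → Set Ω.Point := fun k => {p | Ω.coneDist p₀.1 p.1 < k}
  have hV : ∀ k, IsOpen (V k) := fun k => by
    have : Continuous fun p : Ω.Point => Ω.coneDist p₀.1 p.1 :=
      continuous_coneDist continuous_const continuous_subtype_val (fun _ => p₀.mem_cone)
        Point.mem_cone
    exact isOpen_lt this continuous_const
  obtain ⟨k, hk⟩ := isCompact_univ.elim_directed_cover
    (fun k => (Quotient.mk _ : Ω.Point → Ω.QuotientSpace Γ) '' V k) (fun k => hop _ (hV k))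
    (fun q _ => by
      obtain ⟨p, rfl⟩ := Quotient.exists_rep q
      obtain ⟨k, hk⟩ := exists_nat_gt (Ω.coneDist p₀.1 p.1)
      exact mem_iUnion.2 ⟨k, p, hk, rfl⟩)
    (Monotone.directed_le fun i j hij => image_mono fun p (hp : _ < (i : ℝ)) =>
      lt_of_lt_of_le hp (by exact_mod_cast hij))
  obtain ⟨N, hN, hNs, hNr⟩ := exists_isCompact_nhds (isCompact_singleton (x := p₀.1))
    (singleton_subset_iff.2 p₀.2) k
  refine ⟨N, hN, hNs, fun p => ?_⟩
  obtain ⟨q, hq, hqp⟩ := hk (mem_univ (Quotient.mk _ p))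
  obtain ⟨γ, rfl⟩ := Quotient.exact hqp
  exact ⟨γ, hNr _ rfl _ (γ • p).2 (le_of_lt hq)⟩

/-- The local bounds are uniform on a compact set meeting every orbit. They spread to all points
because γ displaces `p` as much as `g γ g⁻¹` displaces `g p`. -/
theorem exists_uniform_le_coneDist_smul {Γ : Subgroup Ω.aut} [DiscreteTopology Γ]
    [CompactSpace (Ω.QuotientSpace Γ)] (htf : ∀ γ : Γ, γ ≠ 1 → ¬ IsOfFinOrder γ) :
    ∃ r > 0, ∀ (p : Ω.Point) (γ : Γ), γ ≠ 1 → r ≤ Ω.coneDist p.1 (γ • p).1 := by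
  obtain ⟨K, hK, hKs, hsurj⟩ := exists_isCompact_surj Γ
  have hK' : IsCompact {p : Ω.Point | p.1 ∈ K} := by
    rw [Subtype.isCompact_iff]
    convert hK using 1
    ext x
    exact ⟨fun ⟨p, hp, e⟩ => e ▸ hp, fun hx => ⟨⟨x, hKs hx⟩, hx, rfl⟩⟩
  obtain ⟨r, hr, h⟩ : ∃ r > 0, ∀ p ∈ {p : Ω.Point | p.1 ∈ K}, ∀ γ : Γ, γ ≠ 1 →
      r ≤ Ω.coneDist p.1 (γ • p).1 := by
    refine hK'.induction_on (p := fun s : Set Ω.Point => ∃ r > 0, ∀ p ∈ s, ∀ γ : Γ, γ ≠ 1 →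
      r ≤ Ω.coneDist p.1 (γ • p).1) ⟨1, one_pos, by simp⟩ ?_ ?_ ?_
    · rintro s t hst ⟨r, hr, h⟩
      exact ⟨r, hr, fun p hp => h p (hst hp)⟩
    · rintro s t ⟨r, hr, h⟩ ⟨r', hr', h'⟩
      refine ⟨min r r', lt_min hr hr', fun p hp γ hγ => ?_⟩
      rcases hp with hp | hp
      · exact (min_le_left _ _).trans (h p hp γ hγ)
      · exact (min_le_right _ _).trans (h' p hp γ hγ)
    · intro p _
      obtain ⟨r, hr, h⟩ := exists_le_coneDist_smul htf p
      exact ⟨_, mem_nhdsWithin_of_mem_nhds (eventually_coneDist_point_lt p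
        (show 0 < r / 4 by positivity)), r / 2, by positivity,
        fun q hq γ hγ => le_coneDist_smul_of_near (h γ hγ) hq⟩
  refine ⟨r, hr, fun p γ hγ => ?_⟩
  obtain ⟨g, hg⟩ := hsurj p
  have h1 := h _ hg (g * γ * g⁻¹) (fun h => hγ (by simpa using h))
  rw [mul_smul, inv_smul_smul, mul_smul] at h1
  exact h1.trans_eq (Point.coneDist_smul_smul g.1 p (γ • p))

theorem quotDist_mk_le (Γ : Subgroup Ω.aut) (p q : Ω.Point) :
    Ω.quotDist Γ (Quotient.mk _ p) (Quotient.mk _ q) ≤ Ω.coneDist p.1 q.1 := by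
  refine csInf_le ⟨0, ?_⟩ ⟨p, q, rfl, rfl, (hilbertDist_eq p.2 q.2).symm⟩
  rintro _ ⟨x, y, -, -, rfl⟩
  rw [hilbertDist_eq x.2 y.2]
  exact coneDist_nonneg x.mem_cone y.mem_cone

theorem exists_coneDist_lt_of_quotDist_lt (Γ : Subgroup Ω.aut) (p q : Ω.Point) {r : ℝ}
    (h : Ω.quotDist Γ (Quotient.mk _ p) (Quotient.mk _ q) < r) :
    ∃ γ : Γ, Ω.coneDist p.1 (γ • q).1 < r := by
  rw [quotDist] at h
  obtain ⟨_, ⟨x, y, hx, hy, rfl⟩, hlt⟩ :=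
    exists_lt_of_csInf_lt (by exact ⟨_, p, q, rfl, rfl, rfl⟩) h
  rw [hilbertDist_eq x.2 y.2] at hlt
  obtain ⟨g, rfl⟩ := Quotient.exact hx
  obtain ⟨g', rfl⟩ := Quotient.exact hy
  refine ⟨g⁻¹ * g', ?_⟩
  have := Point.coneDist_smul_smul g.1 p ((g⁻¹ * g') • q)
  rw [← this]
  have e : g.1 • (g⁻¹ * g') • q = g' • q := by
    change g • (g⁻¹ * g') • q = g' • q
    rw [smul_smul, mul_inv_cancel_left]
  rw [e]
  exact hlt

/-! ### Short loops -/

theorem segment_mem (p q : Ω.Point) (s : unitInterval) :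
    p.1 + (s : ℝ) • (q.1 - p.1) ∈ Ω.slice := by
  have := Ω.convex p.2 q.2 (a := 1 - s) (b := s) (by linarith [s.2.2]) s.2.1 (by ring)
  have e : p.1 + (s : ℝ) • (q.1 - p.1) = (1 - (s : ℝ)) • p.1 + (s : ℝ) • q.1 := by module
  rw [e]
  exact this

/-- The projective segment between two points. -/
def segmentPath (p q : Ω.Point) : C(unitInterval, Ω.Point) where
  toFun s := ⟨p.1 + (s : ℝ) • (q.1 - p.1), segment_mem p q s⟩
  continuous_toFun := by
    refine Continuous.subtype_mk ?_ _
    exact continuous_const.add (continuous_subtype_val.smul continuous_const)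

/-- Along a line the distances are differences of `linePos`, so the sum telescopes. -/
theorem sum_coneDist_segmentPath_le (p q : Ω.Point) (N : ℕ) (u : ℕ → unitInterval)
    (hu : Monotone u) : ∑ i ∈ Finset.range N,
      Ω.coneDist (segmentPath p q (u i)).1 (segmentPath p q (u (i + 1))).1 ≤
        Ω.coneDist p.1 q.1 := by
  rcases eq_or_ne p q with rfl | hpq
  · have : ∀ s, (segmentPath p p s).1 = p.1 := fun s => by simp [segmentPath]
    simp [this, coneDist_self p.mem_cone]
  have hw : Ω.chart (q.1 - p.1) = 0 := by simp [p.2.1, q.2.1]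
  have hw0 : q.1 - p.1 ≠ 0 := sub_ne_zero.2 fun h => hpq (Subtype.ext h.symm)
  have hd : ∀ s r : unitInterval, s ≤ r →
      Ω.coneDist (segmentPath p q s).1 (segmentPath p q r).1 =
        Ω.linePos p.1 (q.1 - p.1) r - Ω.linePos p.1 (q.1 - p.1) s := fun s r hsr =>
    coneDist_line p.2 hw hw0 (segment_mem p q s) (segment_mem p q r) hsr
  have h0 : (segmentPath p q 0) = p := Subtype.ext (by simp [segmentPath])
  have h1 : (segmentPath p q 1) = q := Subtype.ext (by simp [segmentPath])
  have e1 := hd 0 1 zero_le_one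
  have e2 := hd 0 (u 0) unitInterval.nonneg'
  have e3 := hd (u N) 1 unitInterval.le_one'
  have n1 := coneDist_nonneg (segmentPath p q 0).mem_cone (segmentPath p q (u 0)).mem_cone
  have n2 := coneDist_nonneg (segmentPath p q (u N)).mem_cone (segmentPath p q 1).mem_cone
  rw [h0, h1] at e1
  rw [Finset.sum_congr rfl fun i _ => hd _ _ (hu (Nat.le_succ i)), Finset.sum_range_sub
    (fun i => Ω.linePos p.1 (q.1 - p.1) (u i))]
  linarith

/-- The segment from `p` to `γ p` projects to a loop whose length is at most the displacement. A
homotopy to the constant loop would lift relative to the endpoints and give `γ p = p`. -/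
theorem injRadius_le {Γ : Subgroup Ω.aut} [DiscreteTopology Γ]
    (htf : ∀ γ : Γ, γ ≠ 1 → ¬ IsOfFinOrder γ) (p : Ω.Point) {γ : Γ} (hγ : γ ≠ 1) :
    FlowEntropy.injRadius (Ω.quotDist Γ) ≤ ENNReal.ofReal (Ω.coneDist p.1 (γ • p).1) / 2 := by
  have cov := (isQuotientCoveringMap htf).isCoveringMap
  let π : Ω.Point → Ω.QuotientSpace Γ := Quotient.mk _
  have h0 : segmentPath p (γ • p) 0 = p := Subtype.ext (by simp [segmentPath])
  have h1 : segmentPath p (γ • p) 1 = γ • p := Subtype.ext (by simp [segmentPath])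
  have hπ : π (γ • p) = π p := Quotient.sound ⟨γ, rfl⟩
  let ℓ : Path (π p) (π p) :=
    { toContinuousMap := ContinuousMap.comp ⟨π, cov.continuous⟩ (segmentPath p (γ • p))
      source' := congrArg π h0
      target' := (congrArg π h1).trans hπ }
  have hℓ : ¬ ℓ.Homotopic (Path.refl (π p)) := by
    intro hh
    have h2 := (cov.homotopicRel_iff_comp (f₀ := segmentPath p (γ • p))
      (f₁ := ContinuousMap.const _ p) (S := {0, 1}) ⟨0, Or.inl rfl, h0⟩).2 hh
    have h3 := h2.some
    have h4 := h3.eq_fst 0 (x := 1) (Or.inr rfl)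
    have h5 := h3.eq_snd 0 (x := 1) (Or.inr rfl)
    rw [h4, h1] at h5
    exact hγ (eq_one_of_smul_eq htf h5)
  refine (iInf_le _ (π p)).trans ?_
  unfold FlowEntropy.injRadiusAt
  gcongr
  refine (iInf₂_le ℓ hℓ).trans ?_
  refine iSup_le fun N => iSup_le fun u => iSup_le fun hu => ?_
  rw [← ENNReal.ofReal_sum_of_nonneg]
  · refine ENNReal.ofReal_le_ofReal (le_trans ?_ (sum_coneDist_segmentPath_le p (γ • p) N u hu))
    exact Finset.sum_le_sum fun i _ => quotDist_mk_le Γ _ _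
  · intro i _
    refine Real.sInf_nonneg ?_
    rintro _ ⟨x, y, -, -, rfl⟩
    rw [hilbertDist_eq x.2 y.2]
    exact coneDist_nonneg x.mem_cone y.mem_cone

end ProperlyConvexDomain

end

noncomputable section

/-! ### Bounded spanning numbers give zero entropy -/

namespace FlowEntropy

variable {X : Type*}

/-- One point of `K` for each value of `f` taken on `K` gives a spanning set. Values not taken
receive an arbitrary point of `K`. -/
theorem spanningNumber_le_card {d : X → X → ℝ} {φ : ℝ → X → X} {t δ : ℝ} {K : Set X}
    {ι : Type*} [Fintype ι] (f : X → ι)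
    (hf : ∀ y ∈ K, ∀ u ∈ K, f y = f u → bowenDist d φ t y u < δ) :
    spanningNumber d φ t δ K ≤ Fintype.card ι := by
  classical
  rcases K.eq_empty_or_nonempty with rfl | ⟨u₀, hu₀⟩
  · exact (iInf₂_le (∅ : Finset X) (fun v hv => hv.elim)).trans (by simp)
  have : ∀ i, ∃ u ∈ K, ∀ y ∈ K, f y = i → f u = i := fun i => by
    by_cases h : ∃ u ∈ K, f u = i
    · obtain ⟨u, hu, hi⟩ := h
      exact ⟨u, hu, fun _ _ _ => hi⟩
    · exact ⟨u₀, hu₀, fun y hy hi => (h ⟨y, hy, hi⟩).elim⟩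
  choose g hgK hg using this
  refine (iInf₂_le (Finset.univ.image g) fun v hv => ?_).trans ?_
  · exact ⟨g (f v), Finset.mem_image_of_mem _ (Finset.mem_univ _),
      hf v hv _ (hgK _) (hg (f v) v hv rfl).symm⟩
  · exact_mod_cast Finset.card_image_le

theorem one_le_spanningNumber {d : X → X → ℝ} {φ : ℝ → X → X} {t δ : ℝ} {K : Set X}
    (hK : K.Nonempty) : 1 ≤ spanningNumber d φ t δ K := by
  refine le_iInf₂ fun E hE => ?_
  obtain ⟨v, hv⟩ := hK
  obtain ⟨u, hu, -⟩ := hE v hv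
  exact_mod_cast Finset.card_pos.2 ⟨u, hu⟩

/-- The rate lies between 0 and `log N / t`. Nonemptiness of `K` is needed for the lower bound,
since the spanning number of the empty set is 0, with logarithm `⊥`. -/
theorem entropyAtScale_eq_zero {d : X → X → ℝ} {φ : ℝ → X → X} {K : Set X} {δ : ℝ}
    (hK : K.Nonempty) {N : ℕ} (hN : ∀ t : ℝ, 0 < t → spanningNumber d φ t δ K ≤ N) :
    entropyAtScale d φ K δ = 0 := by
  have hN1 : (1 : ℕ∞) ≤ N := (one_le_spanningNumber hK).trans (hN 1 one_pos)
  have hN0 : N ≠ 0 := by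
    rintro rfl
    simp at hN1
  have hlog : ENNReal.log (N : ℝ≥0∞) = ((Real.log N : ℝ) : EReal) := by
    rw [ENNReal.log_pos_real (by exact_mod_cast hN0) (ENNReal.natCast_ne_top N)]
    simp
  have h1 : Tendsto (fun t : ℝ => ((Real.log N : ℝ) : EReal) / (t : EReal)) atTop (𝓝 0) := by
    have : Tendsto (fun t : ℝ => ((Real.log N / t : ℝ) : EReal)) atTop (𝓝 ((0 : ℝ) : EReal)) :=
      (continuous_coe_real_ereal.tendsto 0).comp (tendsto_const_nhds.div_atTop tendsto_id)
    simpa only [EReal.coe_div, EReal.coe_zero] using this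
  refine Tendsto.limsup_eq (tendsto_of_tendsto_of_tendsto_of_le_of_le' tendsto_const_nhds h1 ?_ ?_)
  · filter_upwards [eventually_gt_atTop 0] with t ht
    refine EReal.div_nonneg ?_ (by exact_mod_cast ht.le)
    rw [← ENNReal.log_one]
    refine ENNReal.log_le_log ?_
    exact_mod_cast one_le_spanningNumber hK
  · filter_upwards [eventually_gt_atTop 0] with t ht
    refine EReal.div_le_div_right_of_nonneg (by exact_mod_cast ht.le) ?_
    rw [← hlog]
    refine ENNReal.log_le_log ?_
    exact_mod_cast hN t ht

theorem topEntropy_eq_zero {d : X → X → ℝ} {φ : ℝ → X → X} {K : Set X} (hK : K.Nonempty)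
    (h : ∀ δ : ℝ, 0 < δ → ∃ N : ℕ, ∀ t : ℝ, 0 < t → spanningNumber d φ t δ K ≤ N) :
    topEntropy d φ K = 0 := by
  have h0 : ∀ δ : ℝ, 0 < δ → entropyAtScale d φ K δ = 0 := fun δ hδ => by
    obtain ⟨N, hN⟩ := h δ hδ
    exact entropyAtScale_eq_zero hK hN
  refine le_antisymm (iSup₂_le fun δ hδ => (h0 δ hδ).le) ?_
  rw [← h0 1 one_pos]
  exact le_iSup₂ (f := fun δ (_ : 0 < δ) => entropyAtScale d φ K δ) 1 one_pos

variable [TopologicalSpace X]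

/-- The metric space structure given by a compatible metric. -/
abbrev IsCompatibleMetric.metricSpace {d : X → X → ℝ} (hd : IsCompatibleMetric d) :
    MetricSpace X :=
  MetricSpace.ofDistTopology d hd.self_eq_zero hd.symm hd.triangle hd.isOpen_iff hd.eq_of_eq_zero

theorem IsCompatibleMetric.continuous {d : X → X → ℝ} (hd : IsCompatibleMetric d) :
    Continuous fun p : X × X => d p.1 p.2 := by
  let := hd.metricSpace
  exact continuous_dist

theorem IsCompatibleMetric.exists_lebesgue_number {d : X → X → ℝ} (hd : IsCompatibleMetric d)
    [CompactSpace X] {ι : Sort*} {c : ι → Set X} (hc : ∀ i, IsOpen (c i))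
    (hcov : ∀ x, ∃ i, x ∈ c i) : ∃ ε > 0, ∀ x, ∃ i, ∀ y, d x y ≤ ε → y ∈ c i := by
  let := hd.metricSpace
  obtain ⟨ε, hε, h⟩ := lebesgue_number_lemma_of_metric isCompact_univ hc
    (fun x _ => mem_iUnion.2 (hcov x))
  refine ⟨ε / 2, half_pos hε, fun x => ?_⟩
  obtain ⟨i, hi⟩ := h x (mem_univ x)
  refine ⟨i, fun y hy => hi ?_⟩
  rw [Metric.mem_ball, dist_comm]
  exact lt_of_le_of_lt hy (half_lt_self hε)

end FlowEntropy

/-! ### Lifting orbits and counting cells -/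

namespace ProperlyConvexDomain

variable {n : ℕ} {Ω : ProperlyConvexDomain n}

namespace UnitTangent

/-- The point at time `t` of the geodesic with initial vector `v`. -/
def pt (v : Ω.UnitTangent) (t : ℝ) : Ω.Point := ⟨v.pos t, v.pos_mem t⟩

theorem pt_smul {Γ : Subgroup Ω.aut} (γ : Γ) (v : Ω.UnitTangent) (t : ℝ) :
    (γ • v).pt t = γ • v.pt t :=
  Subtype.ext (geodesic_act γ.1 v t)

theorem coneDist_smul_pos {Γ : Subgroup Ω.aut} (γ : Γ) (v u : Ω.UnitTangent) (s t : ℝ) :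
    Ω.coneDist ((γ • v).pos s) ((γ • u).pos t) = Ω.coneDist (v.pos s) (u.pos t) := by
  have h1 : (γ • v).pos s = (γ • v.pt s).1 := congrArg Subtype.val (pt_smul γ v s)
  have h2 : (γ • u).pos t = (γ • u.pt t).1 := congrArg Subtype.val (pt_smul γ u t)
  rw [h1, h2]
  exact Point.coneDist_smul_smul γ.1 (v.pt s) (u.pt t)

/-- The class of a unit tangent vector in `SM`. -/
def proj (Γ : Subgroup Ω.aut) (v : Ω.UnitTangent) : Ω.QuotUnitTangent Γ := Quotient.mk _ v

theorem continuous_proj (Γ : Subgroup Ω.aut) : Continuous (proj (Ω := Ω) Γ) :=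
  continuous_quotient_mk'

theorem proj_smul {Γ : Subgroup Ω.aut} (γ : Γ) (v : Ω.UnitTangent) : (γ • v).proj Γ = v.proj Γ :=
  Quotient.sound ⟨γ, rfl⟩

theorem exists_smul_of_proj_eq {Γ : Subgroup Ω.aut} {v u : Ω.UnitTangent}
    (h : v.proj Γ = u.proj Γ) : ∃ γ : Γ, γ • u = v := Quotient.exact h

theorem exists_proj_eq (Γ : Subgroup Ω.aut) (q : Ω.QuotUnitTangent Γ) :
    ∃ v : Ω.UnitTangent, v.proj Γ = q := Quotient.exists_rep q

theorem geodesicFlow_proj (Γ : Subgroup Ω.aut) (t : ℝ) (v : Ω.UnitTangent) :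
    Ω.geodesicFlow Γ t (v.proj Γ) = (Ω.flow t v).proj Γ := rfl

theorem footpoint_proj (Γ : Subgroup Ω.aut) (v : Ω.UnitTangent) :
    Ω.footpoint Γ (v.proj Γ) = Quotient.mk _ (v.pt 0) := by
  have : v.pt 0 = ⟨v.1.1, v.2.1⟩ := Subtype.ext v.pos_zero
  rw [this]
  rfl

theorem flow_smul_group {Γ : Subgroup Ω.aut} (γ : Γ) (t : ℝ) (v : Ω.UnitTangent) :
    Ω.flow t (γ • v) = γ • Ω.flow t v := flow_smul γ.1 t v

end UnitTangent

open UnitTangent FlowEntropy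

variable {Γ : Subgroup Ω.aut}

theorem compactSpace_quotUnitTangent (hc : CompactSpace (Ω.QuotientSpace Γ)) :
    CompactSpace (Ω.QuotUnitTangent Γ) := by
  obtain ⟨K, hK, hKs, hsurj⟩ := exists_isCompact_surj Γ
  have h := (isCompact_preimage hK hKs).image (continuous_proj Γ)
  refine ⟨?_⟩
  convert h
  refine (eq_univ_of_forall fun q => ?_).symm
  obtain ⟨v, rfl⟩ := exists_proj_eq Γ q
  obtain ⟨γ, hγ⟩ := hsurj (v.pt 0)
  refine ⟨γ • v, ?_, proj_smul γ v⟩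
  rw [← pt_smul] at hγ
  change (γ • v).1.1 ∈ K
  rw [← pos_zero]
  exact hγ

/-- For `1 ≤ n` the kernel of the chart contains a nonzero direction. Without unit vectors the
supremum in `hStar` would be `⊥` instead of 0. -/
theorem nonempty_unitTangent (hn : 1 ≤ n) : Nonempty Ω.UnitTangent := by
  obtain ⟨z, hz⟩ := Ω.nonempty
  induction z using Projectivization.ind with | _ z hz0 => ?_
  have hzc := Ω.chart_ne_zero z hz0 hz
  have hx : (Ω.chart z)⁻¹ • z ∈ Ω.slice :=
    ⟨by simp [hzc], mk_smul_mem (inv_ne_zero hzc) ⟨hz0, hz⟩⟩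
  set x := (Ω.chart z)⁻¹ • z
  have hker : LinearMap.ker (Ω.chart : (Fin (n + 1) → ℝ) →ₗ[ℝ] ℝ) ≠ ⊥ := by
    apply LinearMap.ker_ne_bot_of_finrank_lt
    simp
    omega
  obtain ⟨w, hw, hw0⟩ := Submodule.exists_mem_ne_zero_of_ne_bot hker
  have hw : Ω.chart w = 0 := hw
  have h1 := inv_exitTime_pos hx hw hw0
  have h2 := inv_exitTime_neg_pos hx hw hw0
  have hF : 0 < Ω.finslerNorm x w := by
    unfold finslerNorm
    positivity
  refine ⟨⟨(x, (Ω.finslerNorm x w)⁻¹ • w), hx, by simp [hw], ?_⟩⟩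
  have hF' := inv_pos.2 hF
  have e : ∀ c : ℝ, 0 < c → Ω.finslerNorm x (c • w) = c * Ω.finslerNorm x w := fun c hc => by
    rw [finslerNorm, finslerNorm, ← smul_neg, inv_exitTime_smul hx hw hc,
      inv_exitTime_smul hx (by simp [hw]) hc]
    ring
  rw [e _ hF', inv_mul_cancel₀ hF.ne']

/-- Vectors whose geodesics are close at times `0` and `1` are close in `SM`. -/
theorem exists_dist_lt_of_coneDist_lt (hc : CompactSpace (Ω.QuotientSpace Γ))
    {d : Ω.QuotUnitTangent Γ → Ω.QuotUnitTangent Γ → ℝ} (hd : IsCompatibleMetric d) {δ : ℝ}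
    (hδ : 0 < δ) : ∃ η > 0, ∀ v u : Ω.UnitTangent, Ω.coneDist (v.pos 0) (u.pos 0) < η →
      Ω.coneDist (v.pos 1) (u.pos 1) < η → d (v.proj Γ) (u.proj Γ) < δ := by
  obtain ⟨K, hK, hKs, hsurj⟩ := exists_isCompact_surj Γ
  obtain ⟨N, hN, hNs, hNr⟩ := exists_isCompact_nhds hK hKs 1
  have hZ := (isCompact_preimage hK hKs).prod (isCompact_preimage hN hNs)
  have hdc : Continuous fun p : Ω.UnitTangent × Ω.UnitTangent => d (p.1.proj Γ) (p.2.proj Γ) :=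
    hd.continuous.comp (((continuous_proj Γ).comp continuous_fst).prodMk
      ((continuous_proj Γ).comp continuous_snd))
  -- On this compact set of δ-separated pairs, the larger of the distances at times 0 and 1 is
  -- continuous, and by `ext_of_pos` it never vanishes, so it has a positive minimum.
  have hZ' := hZ.inter_right (isClosed_le (continuous_const (y := δ)) hdc)
  have hcont : ∀ t : ℝ, Continuous fun p : Ω.UnitTangent × Ω.UnitTangent =>
      Ω.coneDist (p.1.pos t) (p.2.pos t) := fun t =>
    continuous_coneDist ((continuous_pos t).comp continuous_fst)
      ((continuous_pos t).comp continuous_snd) (fun p => p.1.pos_mem_cone t)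
      fun p => p.2.pos_mem_cone t
  obtain ⟨m, hm, hmin⟩ : ∃ m > 0, ∀ p ∈ ({v : Ω.UnitTangent | v.1.1 ∈ K} ×ˢ
      {v : Ω.UnitTangent | v.1.1 ∈ N}) ∩ {p : Ω.UnitTangent × Ω.UnitTangent |
        δ ≤ d (p.1.proj Γ) (p.2.proj Γ)},
      m ≤ max (Ω.coneDist (p.1.pos 0) (p.2.pos 0)) (Ω.coneDist (p.1.pos 1) (p.2.pos 1)) := by
    rcases Set.eq_empty_or_nonempty (({v : Ω.UnitTangent | v.1.1 ∈ K} ×ˢ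
      {v : Ω.UnitTangent | v.1.1 ∈ N}) ∩ {p : Ω.UnitTangent × Ω.UnitTangent |
        δ ≤ d (p.1.proj Γ) (p.2.proj Γ)}) with h | h
    · exact ⟨1, one_pos, fun p hp => by rw [h] at hp; exact hp.elim⟩
    · obtain ⟨p, hp, hmin⟩ := hZ'.exists_isMinOn h ((hcont 0).max (hcont 1)).continuousOn
      refine ⟨_, ?_, fun q hq => hmin hq⟩
      by_contra! hle
      obtain ⟨h0, h1⟩ := max_le_iff.1 hle
      have h0' := eq_of_coneDist_eq_zero (p.1.pos_mem 0) (p.2.pos_mem 0)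
        (le_antisymm h0 (coneDist_nonneg (p.1.pos_mem_cone 0) (p.2.pos_mem_cone 0)))
      have h1' := eq_of_coneDist_eq_zero (p.1.pos_mem 1) (p.2.pos_mem 1)
        (le_antisymm h1 (coneDist_nonneg (p.1.pos_mem_cone 1) (p.2.pos_mem_cone 1)))
      have h2 : δ ≤ d (p.1.proj Γ) (p.2.proj Γ) := hp.2
      rw [ext_of_pos h0' h1', hd.self_eq_zero] at h2
      linarith
  -- The bound 1 keeps the second footpoint in `N` once the first has been moved into `K`.
  refine ⟨min m 1, lt_min hm one_pos, fun v u h0 h1 => ?_⟩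
  obtain ⟨γ, hγ⟩ := hsurj (v.pt 0)
  rw [← pt_smul] at hγ
  have hγ : (γ • v).pos 0 ∈ K := hγ
  rw [← coneDist_smul_pos γ] at h0 h1
  rw [← proj_smul γ v, ← proj_smul γ u]
  by_contra! hle
  have h2 : (γ • u).pos 0 ∈ N := hNr _ hγ _ ((γ • u).pos_mem 0)
    (h0.le.trans (min_le_right _ _))
  rw [pos_zero] at hγ h2
  have := hmin (γ • v, γ • u) ⟨⟨hγ, h2⟩, hle⟩
  exact absurd (max_lt (h0.trans_le (min_le_left _ _)) (h1.trans_le (min_le_left _ _)))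
    (not_lt.2 this)

/-- Close vectors in `SM` have lifts with close footpoints. -/
theorem exists_lift_of_dist_le (hc : CompactSpace (Ω.QuotientSpace Γ))
    {d : Ω.QuotUnitTangent Γ → Ω.QuotUnitTangent Γ → ℝ} (hd : IsCompatibleMetric d) {r : ℝ}
    (hr : 0 < r) : ∃ ε > 0, ∀ v u : Ω.UnitTangent, d (v.proj Γ) (u.proj Γ) ≤ ε →
      ∃ γ : Γ, Ω.coneDist (v.pos 0) ((γ • u).pos 0) < r := by
  have := compactSpace_quotUnitTangent hc
  -- A Lebesgue number of this cover puts two close vectors into a common `O w`, so that suitable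
  -- lifts are both within `r / 2` of the footpoint of `w`.
  let O : Ω.UnitTangent → Set (Ω.QuotUnitTangent Γ) := fun v =>
    {q | ∃ u : Ω.UnitTangent, u.proj Γ = q ∧ Ω.coneDist (v.pos 0) (u.pos 0) < r / 2}
  have hO : ∀ v, IsOpen (O v) := fun v => by
    have e : proj Γ ⁻¹' O v =
        ⋃ γ : Γ, {u : Ω.UnitTangent | Ω.coneDist ((γ • v).pos 0) (u.pos 0) < r / 2} := by
      ext u
      simp only [mem_iUnion]
      constructor
      · rintro ⟨u', hu', hlt⟩
        obtain ⟨γ, rfl⟩ := exists_smul_of_proj_eq hu'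
        refine ⟨γ⁻¹, ?_⟩
        have := coneDist_smul_pos γ⁻¹ v (γ • u) 0 0
        rw [inv_smul_smul] at this
        exact this.trans_lt hlt
      · rintro ⟨γ, hlt⟩
        refine ⟨γ⁻¹ • u, proj_smul _ _, ?_⟩
        have := coneDist_smul_pos γ⁻¹ (γ • v) u 0 0
        rw [inv_smul_smul] at this
        exact this.trans_lt hlt
    have ho : IsOpen (proj Γ ⁻¹' O v) := by
      rw [e]
      refine isOpen_iUnion fun γ => isOpen_lt ?_ continuous_const
      exact continuous_coneDist continuous_const (continuous_pos 0)
        (fun _ => (γ • v).pos_mem_cone 0) fun u => u.pos_mem_cone 0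
    exact ho
  obtain ⟨ε, hε, h⟩ := hd.exists_lebesgue_number hO fun q => by
    obtain ⟨v, rfl⟩ := exists_proj_eq Γ q
    exact ⟨v, v, rfl, by rw [coneDist_self (v.pos_mem_cone 0)]; positivity⟩
  refine ⟨ε, hε, fun v u hvu => ?_⟩
  obtain ⟨w, hw⟩ := h (v.proj Γ)
  obtain ⟨v', hv', h1⟩ := hw (v.proj Γ) (by rw [hd.self_eq_zero]; exact hε.le)
  obtain ⟨u', hu', h2⟩ := hw _ hvu
  obtain ⟨γ, rfl⟩ := exists_smul_of_proj_eq hv'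
  obtain ⟨γ', rfl⟩ := exists_smul_of_proj_eq hu'
  refine ⟨γ⁻¹ * γ', ?_⟩
  have h3 := coneDist_smul_pos γ⁻¹ (γ • v) (γ' • u) 0 0
  rw [inv_smul_smul, smul_smul] at h3
  rw [h3]
  have h4 := coneDist_triangle ((γ • v).pos_mem_cone 0) (w.pos_mem_cone 0)
    ((γ' • u).pos_mem_cone 0)
  rw [coneDist_comm _ (w.pos 0)] at h4
  linarith

/-- Vectors of `SM` whose orbits stay close have lifts whose orbits stay close. -/
theorem exists_tracking_lift {ρ : ℝ} (hρ : 0 < ρ)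
    (hinj : ∀ (p : Ω.Point) (γ : Γ), γ ≠ 1 → 3 * ρ ≤ Ω.coneDist p.1 (γ • p).1)
    (v u : Ω.UnitTangent)
    (h : ∀ t : ℝ, 0 ≤ t → ∃ γ : Γ, Ω.coneDist (v.pos t) ((γ • u).pos t) < ρ) :
    ∃ γ : Γ, ∀ t : ℝ, 0 ≤ t → Ω.coneDist (v.pos t) ((γ • u).pos t) < ρ := by
  have h' : ∀ t : ℝ, ∃ γ : Γ, 0 ≤ t → Ω.coneDist (v.pos t) ((γ • u).pos t) < ρ := fun t => by
    rcases le_or_gt 0 t with ht | ht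
    · obtain ⟨γ, hγ⟩ := h t ht
      exact ⟨γ, fun _ => hγ⟩
    · exact ⟨1, fun h0 => absurd h0 (not_le.2 ht)⟩
  choose g hg using h'
  -- At time `t` the lifts by `g s` and `g t` are less than ρ/2 + ρ + ρ/2 + ρ = 3ρ apart, going back
  -- to time `s`, across to `v`, forward to time `t` and across again. A nontrivial `g t * (g s)⁻¹`
  -- would displace by at least 3ρ.
  have hloc : ∀ s t : ℝ, 0 ≤ s → 0 ≤ t → |t - s| ≤ ρ / 2 → g t = g s := by
    intro s t hs ht hst
    by_contra hne
    have h1 := hg s hs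
    have h2 := hg t ht
    have h3 := v.coneDist_pos_le s t
    have h4 := (g s • u).coneDist_pos_le s t
    have t1 := coneDist_triangle ((g s • u).pos_mem_cone t) ((g s • u).pos_mem_cone s)
      ((g t • u).pos_mem_cone t)
    have t2 := coneDist_triangle ((g s • u).pos_mem_cone s) (v.pos_mem_cone s)
      ((g t • u).pos_mem_cone t)
    have t3 := coneDist_triangle (v.pos_mem_cone s) (v.pos_mem_cone t)
      ((g t • u).pos_mem_cone t)
    rw [coneDist_comm ((g s • u).pos t) ((g s • u).pos s)] at t1
    rw [coneDist_comm ((g s • u).pos s) (v.pos s)] at t2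
    have h5 := hinj ((g s • u).pt t) (g t * (g s)⁻¹) fun h => hne (mul_inv_eq_one.1 h)
    rw [← pt_smul, mul_smul, inv_smul_smul] at h5
    change 3 * ρ ≤ Ω.coneDist ((g s • u).pos t) ((g t • u).pos t) at h5
    linarith
  have hconst : ∀ k : ℕ, ∀ t : ℝ, 0 ≤ t → t ≤ k * (ρ / 2) → g t = g 0 := by
    intro k
    induction k with
    | zero =>
      intro t h0 h1
      have : t = 0 := le_antisymm (by simpa using h1) h0
      rw [this]
    | succ k ih =>
      intro t h0 h1
      push_cast at h1
      rcases le_or_gt t (ρ / 2) with hle | hgt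
      · exact hloc 0 t le_rfl h0 (by rwa [sub_zero, abs_of_nonneg h0])
      · rw [hloc (t - ρ / 2) t (by linarith) h0 (by
          rw [sub_sub_cancel, abs_of_pos (by positivity)])]
        exact ih _ (by linarith) (by linarith)
  refine ⟨g 0, fun t ht => ?_⟩
  obtain ⟨k, hk⟩ := exists_nat_ge (t / (ρ / 2))
  rw [div_le_iff₀ (by positivity)] at hk
  rw [← hconst k t ht hk]
  exact hg t ht

/-- Balls of a fixed radius are covered by a bounded number of sets of small diameter. -/
theorem exists_uniform_cells (hc : CompactSpace (Ω.QuotientSpace Γ)) (ρ : ℝ) {η : ℝ}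
    (hη : 0 < η) : ∃ t : Finset (Fin (n + 1) → ℝ), ∀ z : Ω.Point,
      ∃ f : Ω.Point → Option t, ∀ p q : Ω.Point, Ω.coneDist z.1 p.1 ≤ ρ → Ω.coneDist z.1 q.1 ≤ ρ →
        f p = f q → Ω.coneDist p.1 q.1 < η := by
  classical
  obtain ⟨K, hK, hKs, hsurj⟩ := exists_isCompact_surj Γ
  obtain ⟨N, hN, hNs, hNr⟩ := exists_isCompact_nhds hK hKs ρ
  obtain ⟨t, htN, hcov⟩ := hN.elim_nhds_subcover
    (fun x => {y | y ∈ Ω.cone ∧ Ω.coneDist x y < η / 2})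
    fun x hx => eventually_coneDist_lt (slice_subset_cone (hNs hx)) (half_pos hη)
  refine ⟨t, fun z => ?_⟩
  obtain ⟨γ, hγ⟩ := hsurj z
  -- Since γ moves `z` into `K`, the same finite cover of `N` serves every centre. The value `none`
  -- is a default for points outside the ball.
  have hex : ∀ p : Ω.Point, ∃ o : Option t, Ω.coneDist z.1 p.1 ≤ ρ →
      ∃ x : t, o = some x ∧ Ω.coneDist x.1 (γ • p).1 < η / 2 := fun p => by
    by_cases hp : Ω.coneDist z.1 p.1 ≤ ρ
    · have h1 : (γ • p).1 ∈ N := hNr _ hγ _ (γ • p).2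
        ((Point.coneDist_smul_smul γ.1 z p).trans_le hp)
      obtain ⟨x, hx, -, hlt⟩ := mem_iUnion₂.1 (hcov h1)
      exact ⟨some ⟨x, hx⟩, fun _ => ⟨⟨x, hx⟩, rfl, hlt⟩⟩
    · exact ⟨none, fun h => absurd h hp⟩
  choose f hf using hex
  refine ⟨f, fun p q hp hq hpq => ?_⟩
  obtain ⟨x, hx, h1⟩ := hf p hp
  obtain ⟨y, hy, h2⟩ := hf q hq
  have hxy : x = y := Option.some_injective _ (by rw [← hx, ← hy, hpq])
  subst hxy
  have h3 := coneDist_triangle (γ • p).mem_cone (slice_subset_cone (hNs (htN x.1 x.2)))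
    (γ • q).mem_cone
  rw [coneDist_comm (γ • p).1 x.1] at h3
  have h4 : Ω.coneDist (γ • p).1 (γ • q).1 = Ω.coneDist p.1 q.1 := Point.coneDist_smul_smul γ.1 p q
  linarith

/-- Each point of the Bowen ball is coded by the cells of its tracking lift at times 0 and `T + 1`.
Equal codes give η/2-closeness at both ends, hence η-closeness in between, and the number of codes
does not depend on `T`. -/
theorem exists_spanningNumber_le (hc : CompactSpace (Ω.QuotientSpace Γ))
    {d : Ω.QuotUnitTangent Γ → Ω.QuotUnitTangent Γ → ℝ} (hd : IsCompatibleMetric d)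
    {ρ ε : ℝ} (hρ : 0 < ρ)
    (hinj : ∀ (p : Ω.Point) (γ : Γ), γ ≠ 1 → 3 * ρ ≤ Ω.coneDist p.1 (γ • p).1)
    (hε : ∀ v u : Ω.UnitTangent, d (v.proj Γ) (u.proj Γ) ≤ ε →
      ∃ γ : Γ, Ω.coneDist (v.pos 0) ((γ • u).pos 0) < ρ)
    (v : Ω.UnitTangent) {δ : ℝ} (hδ : 0 < δ) : ∃ N : ℕ, ∀ T : ℝ, 0 < T →
      spanningNumber d (Ω.geodesicFlow Γ) T δ
        (infBowenBall d (Ω.geodesicFlow Γ) ε (v.proj Γ)) ≤ N := by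
  classical
  -- Half of δ, because a supremum of strictly bounded distances is only weakly bounded.
  obtain ⟨η, hη, hηd⟩ := exists_dist_lt_of_coneDist_lt hc hd (half_pos hδ)
  obtain ⟨c, hcells⟩ := exists_uniform_cells hc ρ (half_pos hη)
  refine ⟨Fintype.card (Option c × Option c), fun T hT => ?_⟩
  obtain ⟨f₀, hf₀⟩ := hcells (v.pt 0)
  -- Closeness in SM at time `s ≤ T` is tested on the points at times `s` and `s + 1`, so control is
  -- needed up to `T + 1`.
  obtain ⟨f₁, hf₁⟩ := hcells (v.pt (T + 1))
  have hlift : ∀ q : Ω.QuotUnitTangent Γ, ∃ u : Ω.UnitTangent, u.proj Γ = q ∧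
      (q ∈ infBowenBall d (Ω.geodesicFlow Γ) ε (v.proj Γ) →
        ∀ t : ℝ, 0 ≤ t → Ω.coneDist (v.pos t) (u.pos t) < ρ) := fun q => by
    obtain ⟨u, rfl⟩ := exists_proj_eq Γ q
    by_cases hq : u.proj Γ ∈ infBowenBall d (Ω.geodesicFlow Γ) ε (v.proj Γ)
    · obtain ⟨γ, hγ⟩ := exists_tracking_lift hρ hinj v u fun t ht => by
        have h1 := hq t ht
        rw [geodesicFlow_proj, geodesicFlow_proj, hd.symm] at h1
        obtain ⟨γ, hγ⟩ := hε _ _ h1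
        rw [← flow_smul_group, pos_flow, pos_flow, add_zero] at hγ
        exact ⟨γ, hγ⟩
      exact ⟨γ • u, proj_smul γ u, fun _ => hγ⟩
    · exact ⟨u, rfl, fun h => absurd h hq⟩
  choose L hL hLt using hlift
  refine spanningNumber_le_card (fun q => (f₀ ((L q).pt 0), f₁ ((L q).pt (T + 1))))
    fun y hy u hu hyu => ?_
  obtain ⟨e0, e1⟩ := Prod.mk.inj hyu
  have hT1 : 0 ≤ T + 1 := by linarith
  have d0 : Ω.coneDist ((L y).pos 0) ((L u).pos 0) < η / 2 :=
    hf₀ ((L y).pt 0) ((L u).pt 0) (hLt y hy 0 le_rfl).le (hLt u hu 0 le_rfl).le e0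
  have d1 : Ω.coneDist ((L y).pos (T + 1)) ((L u).pos (T + 1)) < η / 2 :=
    hf₁ ((L y).pt (T + 1)) ((L u).pt (T + 1)) (hLt y hy _ hT1).le (hLt u hu _ hT1).le e1
  have key : ∀ s : ℝ, 0 ≤ s → s ≤ T + 1 → Ω.coneDist ((L y).pos s) ((L u).pos s) < η :=
    fun s h0 h1 => lt_of_le_of_lt (coneDist_pos_le_add (L y) (L u) h0 h1) (by linarith)
  refine lt_of_le_of_lt (csSup_le ⟨_, 0, ⟨le_rfl, hT.le⟩, rfl⟩ ?_) (half_lt_self hδ)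
  rintro _ ⟨s, ⟨hs0, hsT⟩, rfl⟩
  dsimp only
  rw [← hL y, ← hL u, geodesicFlow_proj, geodesicFlow_proj]
  refine (hηd _ _ ?_ ?_).le
  · rw [pos_flow, pos_flow, add_zero]
    exact key s hs0 (by linarith)
  · rw [pos_flow, pos_flow]
    exact key (s + 1) (by linarith) (by linarith)

theorem isHExpansiveWith_of_lift (hn : 1 ≤ n) (hc : CompactSpace (Ω.QuotientSpace Γ))
    {d : Ω.QuotUnitTangent Γ → Ω.QuotUnitTangent Γ → ℝ} (hd : IsCompatibleMetric d)
    {ρ ε : ℝ} (hρ : 0 < ρ) (hε0 : 0 < ε)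
    (hinj : ∀ (p : Ω.Point) (γ : Γ), γ ≠ 1 → 3 * ρ ≤ Ω.coneDist p.1 (γ • p).1)
    (hε : ∀ v u : Ω.UnitTangent, d (v.proj Γ) (u.proj Γ) ≤ ε →
      ∃ γ : Γ, Ω.coneDist (v.pos 0) ((γ • u).pos 0) < ρ) :
    IsHExpansiveWith d (Ω.geodesicFlow Γ) ε := by
  obtain ⟨v₀⟩ := nonempty_unitTangent (Ω := Ω) hn
  have : Nonempty (Ω.QuotUnitTangent Γ) := ⟨v₀.proj Γ⟩
  have h : ∀ q, topEntropy d (Ω.geodesicFlow Γ) (infBowenBall d (Ω.geodesicFlow Γ) ε q) = 0 := by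
    intro q
    obtain ⟨v, rfl⟩ := exists_proj_eq Γ q
    -- The Bowen ball contains its own centre, so it is not empty.
    refine topEntropy_eq_zero ⟨v.proj Γ, fun t _ => ?_⟩ fun δ hδ =>
      exists_spanningNumber_le hc hd hρ hinj hε v hδ
    rw [hd.self_eq_zero]
    exact hε0.le
  refine ⟨hε0, ?_⟩
  rw [hStar]
  simp only [h]
  exact ciSup_const

end ProperlyConvexDomain

end

/-! ### Choice of the constants for the two claims -/

theorem mainTheorem2 {n : ℕ} (hn : 1 ≤ n) (Ω : ProperlyConvexDomain n) (Γ : Subgroup Ω.aut)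
    (hdiscrete : DiscreteTopology Γ)
    (htorsionFree : ∀ γ : Γ, γ ≠ 1 → ¬ IsOfFinOrder γ)
    (hcompact : CompactSpace (Ω.QuotientSpace Γ)) :
    (∀ d : Ω.QuotUnitTangent Γ → Ω.QuotUnitTangent Γ → ℝ, FlowEntropy.IsCompatibleMetric d →
      ∃ ε : ℝ, FlowEntropy.IsHExpansiveWith d (Ω.geodesicFlow Γ) ε) ∧
    (∀ d : Ω.QuotUnitTangent Γ → Ω.QuotUnitTangent Γ → ℝ, FlowEntropy.IsCompatibleMetric d →
      (∀ v u, Ω.quotDist Γ (Ω.footpoint Γ v) (Ω.footpoint Γ u) ≤ d v u) →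
      ∀ ε : ℝ, 0 < ε → ENNReal.ofReal ε < FlowEntropy.injRadius (Ω.quotDist Γ) / 3 →
        FlowEntropy.IsHExpansiveWith d (Ω.geodesicFlow Γ) ε) := by
  constructor
  · intro d hd
    obtain ⟨r, hr, hinj⟩ := ProperlyConvexDomain.exists_uniform_le_coneDist_smul htorsionFree
    have hρ : 0 < r / 3 := by positivity
    obtain ⟨ε, hε0, hε⟩ := ProperlyConvexDomain.exists_lift_of_dist_le hcompact hd hρ
    exact ⟨ε, ProperlyConvexDomain.isHExpansiveWith_of_lift hn hcompact hd hρ hε0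
      (fun p γ hγ => by linarith [hinj p γ hγ]) hε⟩
  · intro d hd hnorm ε hε0 hε
    -- This number plays the role of ρ. It must exceed ε strictly, because the infimum defining
    -- `quotDist` is only approached by the lifts that are chosen.
    obtain ⟨ρ', hρ1, hρ2⟩ := ENNReal.lt_iff_exists_nnreal_btwn.1 hε
    have hερ : ε < ρ' := by
      rw [ENNReal.ofReal_lt_coe_iff hε0.le] at hρ1
      exact hρ1
    refine ProperlyConvexDomain.isHExpansiveWith_of_lift hn hcompact hd (hε0.trans hερ) hε0
      (fun p γ hγ => ?_) fun v u hvu => ?_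
    -- The displacement is more than `6 * ρ'`, because the injectivity radius is half the length of
    -- a loop; `3 * ρ'` is enough.
    · have h1 := hρ2.trans_le (ENNReal.div_le_div_right
        (ProperlyConvexDomain.injRadius_le htorsionFree p hγ) 3)
      have h0 := ProperlyConvexDomain.coneDist_nonneg p.mem_cone (γ • p).mem_cone
      have h2 : ENNReal.ofReal (Ω.coneDist p.1 (γ • p).1) / 2 / 3 =
          ENNReal.ofReal (Ω.coneDist p.1 (γ • p).1 / 2 / 3) := by
        rw [ENNReal.ofReal_div_of_pos (by norm_num), ENNReal.ofReal_div_of_pos (by norm_num)]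
        simp
      rw [h2, ENNReal.lt_ofReal_iff_toReal_lt ENNReal.coe_ne_top, ENNReal.coe_toReal] at h1
      linarith
    · have h1 := hnorm (v.proj Γ) (u.proj Γ)
      rw [ProperlyConvexDomain.UnitTangent.footpoint_proj,
        ProperlyConvexDomain.UnitTangent.footpoint_proj] at h1
      obtain ⟨γ, hγ⟩ := ProperlyConvexDomain.exists_coneDist_lt_of_quotDist_lt Γ _ _
        ((h1.trans hvu).trans_lt hερ)
      rw [← ProperlyConvexDomain.UnitTangent.pt_smul] at hγ
      exact ⟨γ, hγ⟩
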